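/- **Setting.** Let $X\ge 2$ and let $A$ be an $X\times X$ stochastic matrix for which state $1$ (the target state $e_1$) is absorbing and the states $2,\dots,X$ are transient, so that the change time (the hitting time of state 1) has a phase-type distribution. Observations have conditional densities (or mass functions) $B_{xy}$, $x\in\{1,\dots,X\}$. Let $D_1<\dots<D_L$ be positive integers (the sampling intervals), $f,d\ge 0$ (false alarm and delay penalties) and $m(e_i,u)\ge 0$ (sampling costs). For beliefs $\pi$ in the unit simplex $\Pi(X)$ and actions $u\in\{0 \text{ (stop)},1,\dots,L\}$ put $$C(\pi,0)=f\,(\mathbf 1-e_1)'\pi,\qquad C(\pi,u)=d\,e_1'(I+A+\dots+A^{D_u-1})'\pi+\sum_i m(e_i,u)\pi(i)\quad(u\ge 1).$$ When continue action $u$ is used, the next observation $y$ is taken after $D_u$ time points and the belief becomes $T(\pi,y,u)=B_y(A')^{D_u}\pi/\sigma(\pi,y,u)$ with $B_y=\mathrm{diag}(B_{1y},\dots,B_{Xy})$ and $\sigma(\pi,y,u)=\mathbf 1'B_y(A')^{D_u}\pi$. Let $V(\pi)$ be the infimum, over stationary strategies, of the expected total cost up to and including the stop action, and put $Q(\pi,0)=C(\pi,0)$,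 $Q(\pi,u)=C(\pi,u)+\sum_y V(T(\pi,y,u))\sigma(\pi,y,u)$ for $u\ge1$ ($\sum_y$ being an integral for densities). An optimal strategy is $\mu^*(\pi)\in\arg\min_{0\le u\le L}Q(\pi,u)$; the stopping set is $\mathcal S=\{\pi: Q(\pi,0)\le Q(\pi,u),\ 1\le u\le L\}$ and the myopic stopping set is $\underline{\mathcal S}=\{\pi: C(\pi,0)<C(\pi,u),\ 1\le u\le L\}$. For $\alpha>0$ let $$\bar C(\pi,u)=C(\pi,u)+\alpha d\,e_1'A'\pi-\alpha d\,e_1'(A')^{D_u+1}\pi,\quad u\ge1,\qquad \bar\mu(\pi)\in\arg\min_{1\le u\le L}\bar C(\pi,u).$$ Write $\pi_1\ge_r\pi_2$ (MLR order) if $\pi_1(i)\pi_2(j)\le\pi_2(i)\pi_1(j)$ for all $i<j$. "Increasing" and "decreasing" are meant in the weak sense. Consider the assumptions * (A2) all second order minors of $A$ are non-negative; * (A3) all second order minors of $B$ are non-negative; * (A6) $A_{ij}\,(A^2)_{mk}\le (A^2)_{ij}\,A_{mk}$ for all $i,m$ and all $j<k$; * (A7) $\alpha>0$ and (i) $f\le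 \alpha d(1-A_{21})$, (ii) for every $u\in\{1,\dots,L\}$, $\sum_{l=1}^{D_u-1}(A^l)_{i1}+\alpha\big(A_{i1}-(A^{D_u+1})_{i1}\big)$ is decreasing in $i=2,\dots,X$; * (M) $m(e_i,u)$ is decreasing in $i$ for every $u\in\{1,\dots,L\}$, and $m(e_i,u+1)-m(e_i,u)$ is decreasing in $i$ for $1\le u<L$ (for instance, $m(e_i,u)$ does not depend on $i$). **Theorem.** 1. $\mathcal S$ is a convex subset of $\Pi(X)$ and contains $e_1$. 2. $\underline{\mathcal S}\subset\mathcal S$. 3. Under (A2), (A3), (A6), (A7), (M), $\bar\mu(\pi)\ge\mu^*(\pi)$ for all $\pi\in\Pi(X)-\underline{\mathcal S}$. Moreover $\bar\mu$ is increasing in $\pi$ with respect to the MLR order. 4. If $X=2$ (geometrically distributed change time), then (A2) and (A6) hold automatically; if (A3) and (M) hold and $\alpha>0$ satisfies (A7)(i), then $\bar\mu(\pi)\ge\mu^*(\pi)$ for all $\pi\in\Pi(2)$, and $\bar\mu(\pi)$ is decreasing in $\pi(1)$. When minimizers are not unique, the inequality $\bar\mu\ge\mu^*$ is claimed in the two cases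 where $\mu^*$ always takes the smallest minimizer of $Q(\pi,\cdot)$ ($\bar\mu$ being arbitrary), or $\bar\mu$ always takes the largest minimizer of $\bar C(\pi,\cdot)$ ($\mu^*$ being arbitrary); the monotonicity of $\bar\mu$ is claimed for the selection of the smallest and for that of the largest minimizer. -/

import Mathlib

open MeasureTheory ProbabilityTheory
open scoped ENNReal Matrix

namespace QuickestDetection

/-- All second order minors of the matrix `M` (rows indexed by `Fin k`, columns by a linearly
ordered set) are non-negative. -/
def TP2 {k : ℕ} {ι : Type*} [LinearOrder ι] (M : Fin k → ι → ℝ) : Prop :=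
  ∀ i i' : Fin k, ∀ j j' : ι, i < i' → j < j' → 0 ≤ M i j * M i' j' - M i j' * M i' j

/-- The ordering `A₁ ⪰ A₂` of transition matrices. It implies that the predictor `A₁' π`
dominates `A₂' π` in the monotone likelihood ratio order for every belief `π`. The inequality is
required for all pairs of columns `j < j'`; if no column of `A₁` or `A₂` vanishes, it is enough
to have it for neighbouring columns. -/
def MatrixOrder {k : ℕ} (A₁ A₂ : Matrix (Fin k) (Fin k) ℝ) : Prop :=
  ∀ i m j j' : Fin k, j < j' → A₁ i j * A₂ m j' ≤ A₂ i j * A₁ m j'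

/-- The belief space: the unit simplex of probability vectors on the states. -/
abbrev Belief (k : ℕ) : Type := stdSimplex ℝ (Fin k)

/-- The monotone likelihood ratio order, `π₁ ≥ᵣ π₂`. -/
def MLRGe {k : ℕ} (π₁ π₂ : Belief k) : Prop :=
  ∀ i j : Fin k, i < j → π₁ i * π₂ j ≤ π₂ i * π₁ j

/-- The data of the quickest detection problem with optimal sampling and phase-type change time.
There are `X = n + 2` states; the target state `e₁` has index `0`, the state `e₂` index `1`.
There are `L` sampling intervals; the continue action `u = 1, …, L` has index `u - 1` in `Fin L`. -/
structure Model (n L : ℕ) where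
  /-- transition matrix of the Markov chain -/
  A : Matrix (Fin (n + 2)) (Fin (n + 2)) ℝ
  A_nonneg : ∀ i j, 0 ≤ A i j
  A_row_sum : ∀ i, ∑ j, A i j = 1
  /-- the target state is absorbing -/
  A_absorbing : A 0 0 = 1
  /-- all the other states are transient -/
  A_transient : ∀ i, i ≠ 0 → Summable fun k : ℕ => (A ^ k) i i
  /-- reference measure for the observations, such as Lebesgue measure or the counting measure
  on the integers -/
  ν : Measure ℝ
  ν_sigmaFinite : SigmaFinite ν
  /-- observation density (or mass function) `B x y`, zero for `y` outside the observation space -/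
  B : Fin (n + 2) → ℝ → ℝ
  B_measurable : ∀ x, Measurable (B x)
  B_nonneg : ∀ x y, 0 ≤ B x y
  B_lintegral : ∀ x, ∫⁻ y, ENNReal.ofReal (B x y) ∂ν = 1
  /-- sampling intervals `D₁ < ⋯ < D_L` -/
  D : Fin L → ℕ
  D_pos : ∀ u, 0 < D u
  D_strictMono : StrictMono D
  /-- false alarm penalty -/
  f : ℝ
  f_nonneg : 0 ≤ f
  /-- delay penalty -/
  d : ℝ
  d_nonneg : 0 ≤ d
  /-- measurement sampling cost `m(eᵢ, u)` of a continue action -/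
  m : Fin (n + 2) → Fin L → ℝ
  m_nonneg : ∀ i u, 0 ≤ m i u

attribute [instance] Model.ν_sigmaFinite

namespace Model

variable {n L : ℕ} (M : Model n L)

/-! ### Costs -/

/-- Cost vector of a continue action: `d (I + A + ⋯ + A^(D_u - 1)) e₁ + m_u`. -/
noncomputable def continueCost (u : Fin L) (i : Fin (n + 2)) : ℝ :=
  M.d * (∑ l ∈ Finset.range (M.D u), (M.A ^ l) i 0) + M.m i u

/-- The costs `C(π, u)`; action `0` is stop, action `u.succ` is continue action `u`. -/
noncomputable def cost (π : Belief (n + 2)) (u : Fin (L + 1)) : ℝ :=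
  Fin.cases (M.f * ∑ i, (if i = 0 then 0 else π i)) (fun v => ∑ i, M.continueCost v i * π i) u

/-- The transformed costs `C̄(π, u)` with parameter `α`:
`C̄(π, 0) = C(π, 0) + α d e₁' A' π` and
`C̄(π, u) = C(π, u) + α d e₁' A' π - α d e₁' (A')^(D_u + 1) π` for continue actions. -/
noncomputable def transformedCost (α : ℝ) (π : Belief (n + 2)) (u : Fin (L + 1)) : ℝ :=
  Fin.cases (M.cost π 0 + α * M.d * ∑ i, M.A i 0 * π i)
    (fun v => M.cost π v.succ + α * M.d * ∑ i, M.A i 0 * π i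
      - α * M.d * ∑ i, (M.A ^ (M.D v + 1)) i 0 * π i) u

/-! ### Bayesian filter -/

/-- `B_y (A')^(D_u) π`. -/
noncomputable def unnormalized (π : Belief (n + 2)) (y : ℝ) (u : Fin L) (i : Fin (n + 2)) : ℝ :=
  M.B i y * ∑ j, (M.A ^ M.D u) j i * π j

/-- The normalization measure `σ(π, y, u)`. -/
noncomputable def sigma (π : Belief (n + 2)) (y : ℝ) (u : Fin L) : ℝ :=
  ∑ i, M.unnormalized π y u i

lemma pow_nonneg' (k : ℕ) : ∀ i j, 0 ≤ (M.A ^ k) i j := by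
  induction k with
  | zero =>
    intro i j
    rw [pow_zero, Matrix.one_apply]
    split_ifs <;> norm_num
  | succ k ih =>
    intro i j
    rw [pow_succ, Matrix.mul_apply]
    exact Finset.sum_nonneg fun l _ => mul_nonneg (ih i l) (M.A_nonneg l j)

lemma pow_row_sum (k : ℕ) : ∀ i, ∑ j, (M.A ^ k) i j = 1 := by
  induction k with
  | zero => intro i; simp [Matrix.one_apply]
  | succ k ih =>
    intro i
    simp_rw [pow_succ, Matrix.mul_apply]
    rw [Finset.sum_comm]
    simp_rw [← Finset.mul_sum, M.A_row_sum, mul_one]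
    exact ih i

lemma unnormalized_nonneg (π : Belief (n + 2)) (y : ℝ) (u : Fin L) (i : Fin (n + 2)) :
    0 ≤ M.unnormalized π y u i :=
  mul_nonneg (M.B_nonneg i y)
    (Finset.sum_nonneg fun j _ => mul_nonneg (M.pow_nonneg' _ j i) (π.2.1 j))

open scoped Classical in
/-- The Bayesian filter update `T(π, y, u)`. (Observations with `σ(π, y, u) = 0` have probability
zero; the belief is left unchanged for them.) -/
noncomputable def filter (π : Belief (n + 2)) (y : ℝ) (u : Fin L) : Belief (n + 2) :=
  if h : 0 < M.sigma π y u then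
    ⟨fun i => M.unnormalized π y u i / M.sigma π y u,
      fun i => div_nonneg (M.unnormalized_nonneg π y u i) h.le, by
        rw [← Finset.sum_div]
        exact div_self h.ne'⟩
  else π

lemma measurable_unnormalized (u : Fin L) (i : Fin (n + 2)) :
    Measurable fun p : Belief (n + 2) × ℝ => M.unnormalized p.1 p.2 u i := by
  unfold unnormalized
  refine ((M.B_measurable i).comp measurable_snd).mul ?_
  refine Finset.measurable_sum _ fun j _ => ?_
  exact measurable_const.mul
    ((measurable_pi_apply j).comp (measurable_subtype_coe.comp measurable_fst))

lemma measurable_sigma (u : Fin L) :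
    Measurable fun p : Belief (n + 2) × ℝ => M.sigma p.1 p.2 u :=
  Finset.measurable_sum _ fun i _ => M.measurable_unnormalized u i

lemma measurable_filter (u : Fin L) :
    Measurable fun p : Belief (n + 2) × ℝ => M.filter p.1 p.2 u := by
  classical
  have key : Measurable fun p : Belief (n + 2) × ℝ => (M.filter p.1 p.2 u).1 := by
    refine measurable_pi_lambda _ fun i => ?_
    have h : (fun p : Belief (n + 2) × ℝ => (M.filter p.1 p.2 u).1 i) = fun p =>
        if 0 < M.sigma p.1 p.2 u then M.unnormalized p.1 p.2 u i / M.sigma p.1 p.2 u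
        else p.1.1 i := by
      funext p
      unfold filter
      split_ifs <;> rfl
    rw [h]
    exact Measurable.ite (measurableSet_lt measurable_const (M.measurable_sigma u))
      ((M.measurable_unnormalized u i).div (M.measurable_sigma u))
      ((measurable_pi_apply i).comp (measurable_subtype_coe.comp measurable_fst))
  exact key.subtype_mk

/-! ### The controlled process

At a decision epoch the hidden state is `x` and the belief `π`. Under the continue action `u` the
hidden state moves to `x'` with probability `(A^(D_u)) x x'`, an observation `y` with density
`B x'` is made, and the belief becomes `T(π, y, u)`. -/

/-- Hidden state at a decision epoch together with the belief at this epoch. -/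
abbrev State (n : ℕ) : Type := Fin (n + 2) × Belief (n + 2)

/-- Law of the hidden state `D_u` time points after it was `x`. -/
noncomputable def hiddenKernel (u : Fin L) : Kernel (Fin (n + 2)) (Fin (n + 2)) :=
  Kernel.ofFunOfCountable fun x =>
    ∑ x', ENNReal.ofReal ((M.A ^ M.D u) x x') • Measure.dirac x'

/-- Law of an observation in hidden state `x`. -/
noncomputable def obsKernel : Kernel (Fin (n + 2)) ℝ :=
  Kernel.ofFunOfCountable fun x => M.ν.withDensity fun y => ENNReal.ofReal (M.B x y)

instance (u : Fin L) : IsMarkovKernel (M.hiddenKernel u) where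
  isProbabilityMeasure x := ⟨by
    change (∑ x', ENNReal.ofReal ((M.A ^ M.D u) x x') • Measure.dirac x') Set.univ = 1
    simp only [Measure.coe_finsetSum, Finset.sum_apply, Measure.smul_apply, measure_univ,
      smul_eq_mul, mul_one]
    rw [← ENNReal.ofReal_sum_of_nonneg fun j _ => M.pow_nonneg' _ x j, M.pow_row_sum,
      ENNReal.ofReal_one]⟩

instance : IsMarkovKernel M.obsKernel where
  isProbabilityMeasure x := ⟨by
    change (M.ν.withDensity fun y => ENNReal.ofReal (M.B x y)) Set.univ = 1
    rw [withDensity_apply _ MeasurableSet.univ, Measure.restrict_univ]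
    exact M.B_lintegral x⟩

/-- Joint law of the next hidden state and the next observation. -/
noncomputable def hiddenObsKernel (u : Fin L) : Kernel (Fin (n + 2)) (Fin (n + 2) × ℝ) :=
  M.hiddenKernel u ⊗ₖ Kernel.prodMkLeft (Fin (n + 2)) M.obsKernel

instance (u : Fin L) : IsMarkovKernel (M.hiddenObsKernel u) := by
  unfold hiddenObsKernel; infer_instance

/-- Transition from one decision epoch to the next under the continue action `u`. -/
noncomputable def continueKernel (u : Fin L) : Kernel (State n) (State n) :=
  (Kernel.id ×ₖ (M.hiddenObsKernel u).comap Prod.fst measurable_fst).map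
    fun p : State n × (Fin (n + 2) × ℝ) => (p.2.1, M.filter p.1.2 p.2.2 u)

instance (u : Fin L) : IsMarkovKernel (M.continueKernel u) := by
  unfold continueKernel
  refine Kernel.IsMarkovKernel.map _ ?_
  exact (measurable_fst.comp measurable_snd).prodMk ((M.measurable_filter u).comp
    ((measurable_snd.comp measurable_fst).prodMk (measurable_snd.comp measurable_snd)))

/-- Transition under an arbitrary action; after the stop action the process is frozen. -/
noncomputable def actionKernel (u : Fin (L + 1)) : Kernel (State n) (State n) :=
  Fin.cases Kernel.id (fun v => M.continueKernel v) u

instance (u : Fin (L + 1)) : IsMarkovKernel (M.actionKernel u) := by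
  refine Fin.cases ?_ (fun v => ?_) u
  · change IsMarkovKernel (Kernel.id : Kernel (State n) (State n)); infer_instance
  · change IsMarkovKernel (M.continueKernel v); infer_instance

/-- Stationary strategies: measurable maps from the belief space to the actions. -/
abbrev Strategy (n L : ℕ) : Type :=
  {μ : Belief (n + 2) → Fin (L + 1) // Measurable μ}

/-- Transition between decision epochs when the strategy `μ` is used. -/
noncomputable def strategyKernel (μ : Strategy n L) : Kernel (State n) (State n) where
  toFun z := M.actionKernel (μ.1 z.2) z
  measurable' := by
    have h : Measurable fun p : Fin (L + 1) × State n => M.actionKernel p.1 p.2 :=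
      measurable_from_prod_countable_right fun u => (M.actionKernel u).measurable
    exact h.comp ((μ.2.comp measurable_snd).prodMk measurable_id)

instance (μ : Strategy n L) : IsMarkovKernel (M.strategyKernel μ) where
  isProbabilityMeasure z := by
    change IsProbabilityMeasure (M.actionKernel (μ.1 z.2) z); infer_instance

/-- Law of the hidden state and the belief when the belief is `π`. -/
noncomputable def initialLaw (π : Belief (n + 2)) : Measure (State n) :=
  ∑ x, ENNReal.ofReal (π x) • Measure.dirac (x, π)

/-- The kernel `strategyKernel μ` as a function of the past up to epoch `k`. -/
noncomputable def historyKernel (μ : Strategy n L) (k : ℕ) :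
    Kernel ((i : Finset.Iic k) → (fun _ : ℕ => State n) i) (State n) :=
  (M.strategyKernel μ).comap (fun h => h ⟨k, Finset.mem_Iic.2 le_rfl⟩) (measurable_pi_apply _)

instance (μ : Strategy n L) (k : ℕ) : IsMarkovKernel (M.historyKernel μ k) := by
  unfold historyKernel; infer_instance

/-- The law of the sequence of hidden states and beliefs at the decision epochs, under the
strategy `μ` and with initial belief `π`. -/
noncomputable def pathLaw (μ : Strategy n L) (π : Belief (n + 2)) : Measure (ℕ → State n) :=
  Kernel.trajMeasure (X := fun _ => State n) (initialLaw π) (M.historyKernel μ)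

open scoped Classical in
/-- Total cost along a path: the costs of all epochs up to and including the first one at which
the strategy stops (of all epochs, if it never stops). -/
noncomputable def totalCost (μ : Strategy n L) (ω : ℕ → State n) : ℝ≥0∞ :=
  ∑' k, if ∀ j < k, μ.1 (ω j).2 ≠ 0 then ENNReal.ofReal (M.cost (ω k).2 (μ.1 (ω k).2)) else 0

/-- The objective `J_μ(π)`: expected total cost. -/
noncomputable def objective (μ : Strategy n L) (π : Belief (n + 2)) : ℝ≥0∞ :=
  ∫⁻ ω, M.totalCost μ ω ∂(M.pathLaw μ π)

/-- The optimal value `V(π)`, the infimum of `J_μ(π)` over all stationary strategies. -/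
noncomputable def value (π : Belief (n + 2)) : ℝ≥0∞ :=
  ⨅ μ : Strategy n L, M.objective μ π

/-- `Q(π, u)`: `Q(π, 0) = C(π, 0)` and `Q(π, u) = C(π, u) + ∫ V(T(π, y, u)) σ(π, y, u) dy`. -/
noncomputable def Q (π : Belief (n + 2)) (u : Fin (L + 1)) : ℝ≥0∞ :=
  Fin.cases (ENNReal.ofReal (M.cost π 0))
    (fun v => ENNReal.ofReal (M.cost π v.succ)
      + ∫⁻ y, M.value (M.filter π y v) * ENNReal.ofReal (M.sigma π y v) ∂M.ν) u

/-! ### Stopping sets and strategies -/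

/-- The optimal stopping set. -/
def stoppingSet : Set (Belief (n + 2)) :=
  {π | ∀ u : Fin L, M.Q π 0 ≤ M.Q π u.succ}

/-- The myopic stopping set. -/
def myopicStoppingSet : Set (Belief (n + 2)) :=
  {π | ∀ u : Fin L, M.cost π 0 < M.cost π u.succ}

/-- The set `argmin_u Q(π, u)` over all actions; an optimal strategy selects from it. -/
def optimalActions (π : Belief (n + 2)) : Set (Fin (L + 1)) :=
  {u | ∀ v, M.Q π u ≤ M.Q π v}

/-- The set `argmin_u C̄(π, u)` over the continue actions; the myopic strategy for the transformed
costs selects from it. -/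
def myopicActions (α : ℝ) (π : Belief (n + 2)) : Set (Fin L) :=
  {u | ∀ v : Fin L, M.transformedCost α π u.succ ≤ M.transformedCost α π v.succ}

/-- The belief `e₁`. -/
noncomputable def e1 : Belief (n + 2) :=
  ⟨Pi.single 0 1, single_mem_stdSimplex ℝ 0⟩

/-! ### Assumptions -/

/-- The sampling cost is decreasing in the state and submodular. -/
def SamplingCostMonotone : Prop :=
  (∀ u, Antitone fun i => M.m i u) ∧
    ∀ u v : Fin L, u ≤ v → Antitone fun i => M.m i v - M.m i u

/-- `α` is positive and `α ≥ f / (d (1 - A₂₁))`, the inequality being multiplied out. -/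
def AlphaLarge (α : ℝ) : Prop :=
  0 < α ∧ M.f ≤ α * (M.d * (1 - M.A 1 0))

/-- `∑_{l=1}^{D_u - 1} (A^l)_{i1} + α (A_{i1} - (A^(D_u + 1))_{i1})` is decreasing in
`i = 2, …, X`, for every continue action `u`. -/
def AlphaMonotone (α : ℝ) : Prop :=
  ∀ u : Fin L, ∀ i k : Fin (n + 2), i ≠ 0 → i ≤ k →
    ∑ l ∈ Finset.Icc 1 (M.D u - 1), (M.A ^ l) k 0 + α * (M.A k 0 - (M.A ^ (M.D u + 1)) k 0)
      ≤ ∑ l ∈ Finset.Icc 1 (M.D u - 1), (M.A ^ l) i 0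
        + α * (M.A i 0 - (M.A ^ (M.D u + 1)) i 0)

end Model
end QuickestDetection

/-!
The proof has three parts: dynamic programming, a comparison of actions in the monotone likelihood
ratio (MLR) order, and an inequality on absorption probabilities.

*Dynamic programming.* Averaged over the hidden state, the controlled process is a Markov process
of beliefs (`avg_lintegral_continueKernel`), so the expected cost of a strategy is the limit of its
costs over finitely many epochs (`objective_eq`). These dominate value iteration, and a measurable
greedy strategy attains its limit, so the value is this limit (`value_eq_valueLim`). Value iteration
preserves concavity of functions of the belief, hence the value is concave and the stopping set is
convex.

*Comparison of actions.* Adding the function `α d e₁' A' π` to the value turns the cost `C` into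
`C̄` in the dynamic programming equation (`transformedCost_eq`), and `C̄` is MLR-decreasing by the
assumptions on `α` and the sampling costs. As Bayes' rule and the predictors respect the MLR order,
value iteration preserves the decrease (`expect_le_of_mlrGe`, `mlrAntitone_valueLim`). By `A ⪰ A²`
the predictors decrease with the horizon, so a longer sampling interval has the larger continuation value
(`expect_predict_le`). Hence an interval longer than the myopic one, which is no better for `C̄`, is
no better for `Q` either (`actionValue_add_le`).

*Absorption probabilities.* The myopic action is MLR-monotone once the transformed costs have
decreasing differences (`transformedVec_sub_antitone`). This requires that the probability
`(A^(l+2))_{i1} - (A^(l+1))_{i1}` of absorption at time `l + 2` exactly increases with the initial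
state `i`, for `l ≥ 1` (`OrderedChain.pow_absorb_sub_mono`). Total positivity reduces this to
absorption at time three, that is, to comparing the means of the probability `w` of absorption at time two under two rows of `A`. By summation by parts
(`headSum_mul_nonpos`) it is enough that in each row the mean of `w` over the states below any `J`
is at most its mean over the whole row (`OrderedChain.headSum_exit2_le`). The structure behind this
is rigid: `A ⪰ A²` forces the row of a state and those of the higher states that it reaches to be
proportional from that state on (`OrderedChain.tail_proportional`). So each row is, from a state `L`
of its support on, at least a multiple of the measure `OrderedChain.tail A L`, which the chain
reproduces, up to a factor, from `L` on. A conservation argument compares the mean of `w` below `L`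
with its mean over that measure (`OrderedChain.headSum_exit2_le_tail`), and induction along the
support of the row (`OrderedChain.tail_chain`) passes from the measures `tail A L` to the row.
-/

namespace QuickestDetection

/-! ### Partial sums -/

/-- The sum of `f` over the indices below `J`. -/
def headSum {N : ℕ} (J : ℕ) (f : Fin N → ℝ) : ℝ :=
  ∑ j ∈ Finset.univ.filter (fun j : Fin N => (j : ℕ) < J), f j

lemma headSum_zero {N : ℕ} (f : Fin N → ℝ) : headSum 0 f = 0 := by simp [headSum]

lemma headSum_succ {N : ℕ} (f : Fin N → ℝ) (k : Fin N) :
    headSum (k + 1) f = headSum k f + f k := by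
  have : Finset.univ.filter (fun j : Fin N => (j : ℕ) < k + 1)
      = insert k (Finset.univ.filter fun j : Fin N => (j : ℕ) < k) := by
    ext j
    simp only [Finset.mem_filter, Finset.mem_univ, true_and, Finset.mem_insert, Fin.ext_iff]
    omega
  rw [headSum, this, Finset.sum_insert (by simp), add_comm, headSum]

lemma headSum_all {N : ℕ} (f : Fin N → ℝ) : headSum N f = ∑ j, f j := by
  simp [headSum]

lemma headSum_nonneg {N : ℕ} {f : Fin N → ℝ} (hf : ∀ j, 0 ≤ f j) (J : ℕ) : 0 ≤ headSum J f :=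
  Finset.sum_nonneg fun j _ => hf j

lemma headSum_eq_zero {N : ℕ} {f : Fin N → ℝ} {J : ℕ} (hf : ∀ j : Fin N, (j : ℕ) < J → f j = 0) :
    headSum J f = 0 :=
  Finset.sum_eq_zero fun j hj => hf j (by simpa using hj)

lemma eq_zero_of_headSum_eq_zero {N : ℕ} {f : Fin N → ℝ} (hf : ∀ j, 0 ≤ f j) {J : ℕ}
    (h : headSum J f = 0) {j : Fin N} (hj : (j : ℕ) < J) : f j = 0 :=
  (Finset.sum_eq_zero_iff_of_nonneg fun j _ => hf j).1 h j (by simpa using hj)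

lemma headSum_sub_mul {N : ℕ} (J : ℕ) (x g : Fin N → ℝ) (s t : ℝ) :
    headSum J (fun j => x j * (g j * s - t)) = headSum J (fun j => x j * g j) * s
      - headSum J x * t := by
  simp only [headSum, Finset.sum_mul, ← Finset.sum_sub_distrib]
  exact Finset.sum_congr rfl fun j _ => by ring

lemma headSum_eq_sum_ite {N : ℕ} (J : ℕ) (f : Fin N → ℝ) :
    headSum J f = ∑ j : Fin N, if (j : ℕ) < J then f j else 0 := by
  rw [headSum, Finset.sum_filter]

/-- Summation by parts for the monotone likelihood ratio order: if `x` dominates `p` and all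
partial sums of `x * g` are nonpositive, then so are those of `p * g`. Below the support of `x`
the order gives no information on `p`, so there `g` itself has to be nonpositive. -/
lemma headSum_mul_nonpos {N : ℕ} {x p g : Fin N → ℝ} (hx : ∀ j, 0 ≤ x j) (hp : ∀ j, 0 ≤ p j)
    (hxp : ∀ j k, j < k → p k * x j ≤ p j * x k) {J : ℕ} (hJ : J ≤ N)
    (hS : ∀ J' ≤ J, headSum J' (fun j => x j * g j) ≤ 0)
    (hlow : ∀ j : Fin N, (j : ℕ) < J → (∀ k ≤ j, x k = 0) → g j ≤ 0) :
    headSum J (fun j => p j * g j) ≤ 0 := by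
  -- the second clause carries the comparison of the partial sums, without division by `x l`
  suffices H : ∀ k ≤ J, headSum k (fun j => p j * g j) ≤ 0 ∧ ∀ l : Fin N, k ≤ (l : ℕ) →
      x l * headSum k (fun j => p j * g j) ≤ p l * headSum k (fun j => x j * g j) from
    (H J le_rfl).1
  intro k
  induction k with
  | zero => intro _; simp [headSum_zero]
  | succ k ih =>
    intro hk
    obtain ⟨hP, hl⟩ := ih (by omega)
    have hkN : k < N := by omega
    set q : Fin N := ⟨k, hkN⟩
    have e1 : ∀ f : Fin N → ℝ, headSum (k + 1) f = headSum k f + f q := fun f =>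
      headSum_succ f q
    have hS1 := hS (k + 1) hk
    rw [e1] at hS1
    simp only [e1]
    set P := headSum k fun j => p j * g j
    set S := headSum k fun j => x j * g j
    have hq := hl q le_rfl
    rcases le_or_gt (g q) 0 with hg | hg
    · refine ⟨by nlinarith [mul_nonneg (hp q) (neg_nonneg.2 hg)], fun l hkl => ?_⟩
      have h1 := hl l (by omega)
      have h2 := hxp q l (by rw [Fin.lt_def]; exact hkl)
      nlinarith [mul_nonneg (sub_nonneg.2 h2) (neg_nonneg.2 hg)]
    · by_cases hxq : x q = 0
      · have hpq : p q = 0 := by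
          by_contra hne
          refine absurd (hlow q (show k < J by omega) fun j hj => ?_) (not_le.2 hg)
          by_contra hxj
          have hjq : j < q := lt_of_le_of_ne hj fun h => hxj (h ▸ hxq)
          have h3 := hxp j q hjq
          rw [hxq, mul_zero] at h3
          exact absurd h3 (not_le.2 (mul_pos (lt_of_le_of_ne (hp q) (Ne.symm hne))
            (lt_of_le_of_ne (hx j) (Ne.symm hxj))))
        simp only [hxq, hpq, zero_mul, add_zero]
        exact ⟨hP, fun l hkl => hl l (by omega)⟩
      · have hxq' : 0 < x q := lt_of_le_of_ne (hx q) (Ne.symm hxq)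
        have h4 : x q * (P + p q * g q) ≤ p q * (S + x q * g q) := by nlinarith
        refine ⟨?_, fun l hkl => ?_⟩
        · have : x q * (P + p q * g q) ≤ 0 := h4.trans (mul_nonpos_of_nonneg_of_nonpos (hp q) hS1)
          by_contra hcon
          exact absurd this (not_le.2 (mul_pos hxq' (not_le.1 hcon)))
        · have h2 := hxp q l (by rw [Fin.lt_def]; exact hkl)
          refine le_of_mul_le_mul_left ?_ hxq'
          calc x q * (x l * (P + p q * g q)) = x l * (x q * (P + p q * g q)) := by ring
            _ ≤ x l * (p q * (S + x q * g q)) := mul_le_mul_of_nonneg_left h4 (hx l)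
            _ = (p q * x l) * (S + x q * g q) := by ring
            _ ≤ (p l * x q) * (S + x q * g q) := mul_le_mul_of_nonpos_right h2 hS1
            _ = x q * (p l * (S + x q * g q)) := by ring

/-- If `q` dominates `p` and `y` dominates `x`, in the monotone likelihood ratio order, pairing
the like-ordered vectors gives the larger product. -/
lemma sum_mul_sum_le_swap {N : ℕ} {x y p q : Fin N → ℝ}
    (hxy : ∀ j k, j < k → y j * x k ≤ x j * y k) (hpq : ∀ j k, j < k → p j * q k ≤ q j * p k) :
    (∑ j, x j * p j) * ∑ k, y k * q k ≤ (∑ j, x j * q j) * ∑ k, y k * p k := by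
  have h : ∀ j k, (x j * y k - x k * y j) * (p j * q k - q j * p k) ≤ 0 := by
    intro j k
    rcases lt_trichotomy j k with h | h | h
    · exact mul_nonpos_of_nonneg_of_nonpos (by linarith [hxy j k h]) (by linarith [hpq j k h])
    · simp [h, mul_comm]
    · exact mul_nonpos_of_nonpos_of_nonneg (by linarith [hxy k j h]) (by linarith [hpq k j h])
  have hs : ∑ j, ∑ k, (x j * y k - x k * y j) * (p j * q k - q j * p k) ≤ 0 :=
    Finset.sum_nonpos fun j _ => Finset.sum_nonpos fun k _ => h j k
  have e : ∑ j, ∑ k, (x j * y k - x k * y j) * (p j * q k - q j * p k)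
      = 2 * ((∑ j, x j * p j) * (∑ k, y k * q k) - (∑ j, x j * q j) * ∑ k, y k * p k) := by
    have e1 : ∑ j, ∑ k, (x k * y j) * (p j * q k - q j * p k)
        = ∑ j, ∑ k, (x j * y k) * (p k * q j - q k * p j) := Finset.sum_comm
    simp only [sub_mul (x _ * y _), Finset.sum_sub_distrib, e1]
    rw [Finset.sum_mul_sum, Finset.sum_mul_sum, ← Finset.sum_sub_distrib,
      ← Finset.sum_sub_distrib, Finset.mul_sum]
    refine Finset.sum_congr rfl fun j _ => ?_
    rw [← Finset.sum_sub_distrib, ← Finset.sum_sub_distrib, Finset.mul_sum]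
    exact Finset.sum_congr rfl fun k _ => by ring
  linarith

/-- Chebyshev's inequality: a decreasing function has the smaller mean under the measure that is
larger in the monotone likelihood ratio order. -/
lemma sum_mul_sum_le_of_mlr {N : ℕ} {x η a : Fin N → ℝ} (ha : Antitone a)
    (hxη : ∀ j k, j < k → x j * η k ≤ x k * η j) :
    (∑ j, x j * a j) * ∑ k, η k ≤ (∑ j, x j) * ∑ k, η k * a k := by
  have h := sum_mul_sum_le_swap (x := a) (y := fun _ => 1) (p := x) (q := η)
    (fun j k hjk => by rw [one_mul, mul_one]; exact ha hjk.le)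
    (fun j k hjk => by rw [mul_comm (η j)]; exact hxη j k hjk)
  simp only [one_mul, mul_comm (a _)] at h
  rwa [mul_comm (∑ j, η j * a j)] at h

/-! ### Totally positive chains with `A ⪰ A²` -/

lemma TP2.antitone_col_zero {n : ℕ} {A : Matrix (Fin (n + 2)) (Fin (n + 2)) ℝ} (hA : TP2 A)
    (hsum : ∀ i, ∑ j, A i j = 1) : Antitone fun i => A i 0 := by
  refine antitone_iff_forall_lt.2 fun i k hik => ?_
  have h : ∑ j, A i j * A k 0 ≤ ∑ j, A i 0 * A k j := by
    refine Finset.sum_le_sum fun j _ => ?_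
    rcases eq_or_ne j 0 with rfl | hj
    · exact le_rfl
    · exact sub_nonneg.1 (hA i k 0 j hik (Fin.pos_of_ne_zero hj))
  rwa [← Finset.sum_mul, ← Finset.mul_sum, hsum, hsum, one_mul, mul_one] at h

lemma row_zero_eq_zero {n : ℕ} {A : Matrix (Fin (n + 2)) (Fin (n + 2)) ℝ}
    (hnonneg : ∀ i j, 0 ≤ A i j) (hsum : ∀ i, ∑ j, A i j = 1) (h0 : A 0 0 = 1)
    {j : Fin (n + 2)} (hj : j ≠ 0) : A 0 j = 0 := by
  have h := hsum 0
  rw [← Finset.add_sum_erase _ _ (Finset.mem_univ (0 : Fin (n + 2))), h0] at h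
  have h2 : ∑ x ∈ Finset.univ.erase (0 : Fin (n + 2)), A 0 x = 0 := by linarith
  exact (Finset.sum_eq_zero_iff_of_nonneg fun i _ => hnonneg 0 i).1 h2 j (by simp [hj])

/-- A stochastic matrix with absorbing state `0` and all other states transient, whose second order
minors are nonnegative and which satisfies `A ⪰ A²`. -/
structure OrderedChain {n : ℕ} (A : Matrix (Fin (n + 2)) (Fin (n + 2)) ℝ) : Prop where
  nonneg : ∀ i j, 0 ≤ A i j
  row_sum : ∀ i, ∑ j, A i j = 1
  absorbing : A 0 0 = 1
  transient : ∀ i, i ≠ 0 → Summable fun k : ℕ => (A ^ k) i i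
  tp2 : TP2 A
  order : MatrixOrder A (A ^ 2)

namespace OrderedChain

variable {n : ℕ} {A : Matrix (Fin (n + 2)) (Fin (n + 2)) ℝ}

lemma sq_apply (A : Matrix (Fin (n + 2)) (Fin (n + 2)) ℝ) (i j : Fin (n + 2)) :
    (A ^ 2) i j = ∑ l, A i l * A l j := by
  rw [pow_two, Matrix.mul_apply]

lemma zero_row (hA : OrderedChain A) {j : Fin (n + 2)} (hj : j ≠ 0) : A 0 j = 0 :=
  row_zero_eq_zero hA.nonneg hA.row_sum hA.absorbing hj

/-- The chance of being in a transient state decreases from time one to time two. -/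
lemma sq_le (hA : OrderedChain A) (m : Fin (n + 2)) {k : Fin (n + 2)} (hk : k ≠ 0) :
    (A ^ 2) m k ≤ A m k := by
  have h := hA.order 0 m 0 k (Fin.pos_of_ne_zero hk)
  have h2 : (A ^ 2) 0 0 = 1 := by
    rw [sq_apply, Finset.sum_eq_single 0]
    · simp [hA.absorbing]
    · intro b _ hb; simp [hA.zero_row hb]
    · simp
  rwa [hA.absorbing, h2, one_mul, one_mul] at h

lemma mul_le_sq (hA : OrderedChain A) (i l j : Fin (n + 2)) :
    A i l * A l j ≤ (A ^ 2) i j := by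
  rw [sq_apply]
  exact Finset.single_le_sum (f := fun l => A i l * A l j)
    (fun l _ => mul_nonneg (hA.nonneg i l) (hA.nonneg l j)) (Finset.mem_univ l)

/-- Transient states that are reachable in two steps are reachable in one. -/
lemma pos_trans (hA : OrderedChain A) {m b k : Fin (n + 2)} (hk : k ≠ 0) (hmb : 0 < A m b)
    (hbk : 0 < A b k) : 0 < A m k :=
  (mul_pos hmb hbk).trans_le ((hA.mul_le_sq m b k).trans (hA.sq_le m hk))

lemma minor (hA : OrderedChain A) {i i' j j' : Fin (n + 2)} (hi : i < i') (hj : j < j') :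
    A i j' * A i' j ≤ A i j * A i' j' :=
  sub_nonneg.1 (hA.tp2 i i' j j' hi hj)

lemma exists_pos (hA : OrderedChain A) (i : Fin (n + 2)) : ∃ j, 0 < A i j := by
  by_contra! h
  have := hA.row_sum i
  rw [Finset.sum_eq_zero fun j _ => le_antisymm (h j) (hA.nonneg i j)] at this
  exact zero_ne_one this

lemma eq_zero_of_not_pos (hA : OrderedChain A) {i j : Fin (n + 2)} (h : ¬ 0 < A i j) :
    A i j = 0 := le_antisymm (not_lt.1 h) (hA.nonneg i j)

/-! ### Rows of states that communicate -/

/-- If `b` can be reached from a lower state `a`, the rows `a` and `b` are proportional on the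
columns from `a` on. -/
def TailProp (A : Matrix (Fin (n + 2)) (Fin (n + 2)) ℝ) (a : Fin (n + 2)) : Prop :=
  ∀ b j k, a < b → 0 < A a b → a ≤ j → a ≤ k → A a j * A b k = A a k * A b j

lemma diag_pos_of_tailProp (hA : OrderedChain A) {a b : Fin (n + 2)} (ha : TailProp A a)
    (hab : a < b) (hb : 0 < A a b) : 0 < A b b := by
  by_contra h
  have h0 := hA.eq_zero_of_not_pos h
  obtain ⟨j, hj⟩ := hA.exists_pos b
  rcases lt_or_ge j a with hja | hja
  · have := hA.minor hab (hja.trans hab)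
    rw [h0, mul_zero] at this
    exact absurd this (not_le.2 (mul_pos hb hj))
  · have := ha b b j hab hb hab.le hja
    rw [h0, mul_zero] at this
    exact absurd this (mul_pos hb hj).ne'

/-- The rows of `l` and of a higher state `a` are proportional on the columns from `a` on: if `l`
reaches some `b ≥ a`, the row of `a` is squeezed between the proportional rows of `l` and `b`. -/
lemma tail_eq_of_tailProp (hA : OrderedChain A) {l a j k : Fin (n + 2)} (hl : TailProp A l)
    (hla : l < a) (hj : a ≤ j) (hk : a ≤ k) : A l k * A a j = A l j * A a k := by
  wlog hjk : j < k generalizing j k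
  · rcases (not_lt.1 hjk).lt_or_eq with h | h
    · exact (this hk hj h).symm
    · rw [h]
  by_cases h : ∃ b, a ≤ b ∧ 0 < A l b
  · obtain ⟨b, hab, hb⟩ := h
    rcases hab.eq_or_lt with rfl | hab
    · exact (hl a k j hla hb (hla.le.trans hk) (hla.le.trans hj))
    · have hbb := hA.diag_pos_of_tailProp hl (hla.trans hab) hb
      have hlb : ∀ {i}, a ≤ i → A l b * A b i = A l i * A b b := fun {i} hi =>
        hl b b i (hla.trans hab) hb (hla.trans hab).le (hla.le.trans hi)
      refine le_antisymm (hA.minor hla hjk) ?_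
      have h1 := hA.minor hab hjk
      -- multiply the minor of the rows `a`, `b` by `A l b`
      have h2 : A l b * (A a k * A b j) ≤ A l b * (A a j * A b k) :=
        mul_le_mul_of_nonneg_left h1 hb.le
      refine le_of_mul_le_mul_right ?_ hbb
      calc A l j * A a k * A b b = A a k * (A l j * A b b) := by ring
        _ = A l b * (A a k * A b j) := by rw [← hlb hj]; ring
        _ ≤ A l b * (A a j * A b k) := h2
        _ = A a j * (A l k * A b b) := by rw [← hlb hk]; ring
        _ = A l k * A a j * A b b := by ring
  · push Not at h
    rw [le_antisymm (h j hj) (hA.nonneg l j), le_antisymm (h k hk) (hA.nonneg l k)]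
    ring

lemma tailProp (hA : OrderedChain A) (a : Fin (n + 2)) : TailProp A a := by
  induction a using WellFoundedLT.induction with
  | ind a ih =>
    intro b j k hab hb hj hk
    wlog hjk : j < k generalizing j k
    · rcases (not_lt.1 hjk).lt_or_eq with h | h
      · exact (this k j hk hj h).symm
      · rw [h]
    -- `A ⪰ A²` bounds a sum of terms which are all nonnegative
    have h := hA.order a a j k hjk
    rw [sq_apply, sq_apply, Finset.mul_sum, Finset.sum_mul] at h
    have hterm : ∀ l, 0 ≤ A a j * (A a l * A l k) - A a l * A l j * A a k := by
      intro l
      have e : A a j * (A a l * A l k) - A a l * A l j * A a k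
          = A a l * (A l k * A a j - A l j * A a k) := by ring
      rw [e]
      rcases lt_trichotomy l a with hla | rfl | hla
      · rw [hA.tail_eq_of_tailProp (ih l hla) hla hj hk, sub_self, mul_zero]
      · rw [mul_comm (A l k), sub_self, mul_zero]
      · exact mul_nonneg (hA.nonneg a l) (by linarith [hA.minor hla hjk])
    have hsum : ∑ l, (A a j * (A a l * A l k) - A a l * A l j * A a k) = 0 :=
      le_antisymm (by rw [Finset.sum_sub_distrib]; linarith)
        (Finset.sum_nonneg fun l _ => hterm l)
    have hb0 := (Finset.sum_eq_zero_iff_of_nonneg fun l _ => hterm l).1 hsum b (Finset.mem_univ b)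
    have : A a b * (A a j * A b k - A a k * A b j) = 0 := by linarith
    exact sub_eq_zero.1 ((mul_eq_zero.1 this).resolve_left hb.ne')

lemma tail_proportional (hA : OrderedChain A) {a b j k : Fin (n + 2)} (hab : a < b)
    (hb : 0 < A a b) (hj : a ≤ j) (hk : a ≤ k) : A a j * A b k = A a k * A b j :=
  hA.tailProp a b j k hab hb hj hk

lemma tail_eq (hA : OrderedChain A) {l a j k : Fin (n + 2)} (hla : l < a) (hj : a ≤ j)
    (hk : a ≤ k) : A l k * A a j = A l j * A a k :=
  hA.tail_eq_of_tailProp (hA.tailProp l) hla hj hk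

lemma diag_pos (hA : OrderedChain A) {a b : Fin (n + 2)} (hab : a < b) (hb : 0 < A a b) :
    0 < A b b :=
  hA.diag_pos_of_tailProp (hA.tailProp a) hab hb

/-- A row dominates, on the columns from `L` on, the row of each state `L` that it reaches. -/
lemma row_dominates (hA : OrderedChain A) {m L j k : Fin (n + 2)} (hL : 0 < A m L) (hj : L ≤ j)
    (hjk : j < k) : A L k * A m j ≤ A L j * A m k := by
  rcases lt_trichotomy m L with h | rfl | h
  · have := hA.tail_proportional h hL (h.le.trans hj) (h.le.trans (hj.trans hjk.le))
    rw [mul_comm (A L k), mul_comm (A L j), this]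
  · rw [mul_comm]
  · exact hA.minor h hjk

lemma diag_pos_of_between (hA : OrderedChain A) {m j L b : Fin (n + 2)} (hj : 0 < A m j)
    (hL : 0 < A m L) (hjL : j ≤ L) (hLb : L < b) (hjb : 0 < A j b) : 0 < A L L := by
  have h1 := hA.row_dominates hj hjL hLb
  have h2 : 0 < A j L := by
    by_contra hcon
    rw [hA.eq_zero_of_not_pos hcon, zero_mul] at h1
    exact absurd h1 (not_le.2 (mul_pos hjb hL))
  rcases hjL.eq_or_lt with rfl | h
  · exact h2
  · exact hA.diag_pos h h2

/-! ### Exit laws and survival -/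

lemma absorb_antitone (hA : OrderedChain A) : Antitone fun i => A i 0 :=
  hA.tp2.antitone_col_zero hA.row_sum

lemma sum_ite_eq_zero (g : Fin (n + 2) → ℝ) :
    (∑ b, if b = 0 then 0 else g b) = ∑ b, g b - g 0 := by
  rw [← Finset.add_sum_erase _ _ (Finset.mem_univ (0 : Fin (n + 2))),
    ← Finset.add_sum_erase (f := g) _ (Finset.mem_univ (0 : Fin (n + 2))), if_pos rfl, zero_add,
    add_sub_cancel_left]
  exact Finset.sum_congr rfl fun b hb => if_neg (Finset.ne_of_mem_erase hb)

/-- The probability of being absorbed at time two exactly. -/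
def exit2 (A : Matrix (Fin (n + 2)) (Fin (n + 2)) ℝ) (i : Fin (n + 2)) : ℝ :=
  (A ^ 2) i 0 - A i 0

lemma exit2_eq (hA : OrderedChain A) (i : Fin (n + 2)) :
    exit2 A i = ∑ b, if b = 0 then 0 else A i b * A b 0 := by
  rw [exit2, sq_apply, sum_ite_eq_zero, hA.absorbing, mul_one]

lemma surv_eq (hA : OrderedChain A) (i : Fin (n + 2)) :
    1 - A i 0 = ∑ b, if b = 0 then 0 else A i b := by
  rw [sum_ite_eq_zero, hA.row_sum i]

lemma exit2_nonneg (hA : OrderedChain A) (i : Fin (n + 2)) : 0 ≤ exit2 A i := by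
  rw [hA.exit2_eq]
  refine Finset.sum_nonneg fun b _ => ?_
  split_ifs
  · exact le_rfl
  · exact mul_nonneg (hA.nonneg i b) (hA.nonneg b 0)

lemma le_one (hA : OrderedChain A) (i j : Fin (n + 2)) : A i j ≤ 1 := by
  rw [← hA.row_sum i]
  exact Finset.single_le_sum (f := A i) (fun l _ => hA.nonneg i l) (Finset.mem_univ j)

lemma exit2_le (hA : OrderedChain A) (i : Fin (n + 2)) : exit2 A i ≤ 1 - A i 0 := by
  rw [hA.exit2_eq, hA.surv_eq]
  refine Finset.sum_le_sum fun b _ => ?_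
  split_ifs
  · exact le_rfl
  · exact mul_le_of_le_one_right (hA.nonneg i b) (hA.le_one b 0)

/-- `exit2` as a difference of survival probabilities. -/
lemma exit2_eq_sub (hA : OrderedChain A) (i : Fin (n + 2)) :
    exit2 A i = (1 - A i 0) - ∑ b, A i b * (1 - A b 0) := by
  simp only [mul_sub, mul_one, Finset.sum_sub_distrib, hA.row_sum, exit2, sq_apply]
  ring

/-! ### The tail measure of a state -/

/-- The row of the state `L` restricted to the states from `L` on, or the unit mass at `L` if the
chain cannot stay in `L`. Every row `x` with `x L > 0` has, on the states from `L` on, at least the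
density `x L / tail L L` with respect to `tail L`. -/
noncomputable def tail (A : Matrix (Fin (n + 2)) (Fin (n + 2)) ℝ) (L k : Fin (n + 2)) : ℝ :=
  if 0 < A L L then (if L ≤ k then A L k else 0) else (if k = L then 1 else 0)

lemma tail_nonneg (hA : OrderedChain A) (L k : Fin (n + 2)) : 0 ≤ tail A L k := by
  unfold tail
  split_ifs <;> first | exact hA.nonneg _ _ | norm_num

lemma tail_self_pos (A : Matrix (Fin (n + 2)) (Fin (n + 2)) ℝ) (L : Fin (n + 2)) :
    0 < tail A L L := by
  unfold tail
  split_ifs with h1 h2 h3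
  · exact h1
  · exact absurd le_rfl h2
  · norm_num
  · exact absurd rfl h3

lemma tail_of_lt {L k : Fin (n + 2)} (h : k < L) : tail A L k = 0 := by
  unfold tail
  simp [not_le.2 h, h.ne]

lemma tail_of_not_pos {L : Fin (n + 2)} (h : ¬ 0 < A L L) (k : Fin (n + 2)) :
    tail A L k = if k = L then 1 else 0 := by
  unfold tail; rw [if_neg h]

lemma tail_of_pos {L k : Fin (n + 2)} (h : 0 < A L L) (hk : L ≤ k) : tail A L k = A L k := by
  unfold tail; rw [if_pos h, if_pos hk]

lemma sum_tail_pos (hA : OrderedChain A) (L : Fin (n + 2)) : 0 < ∑ k, tail A L k :=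
  (tail_self_pos A L).trans_le
    (Finset.single_le_sum (fun k _ => hA.tail_nonneg L k) (Finset.mem_univ L))

lemma tail_mul_le (hA : OrderedChain A) {m L k : Fin (n + 2)} (hL : 0 < A m L) :
    tail A L k * A m L ≤ tail A L L * A m k := by
  have h0 := mul_nonneg (tail_self_pos A L).le (hA.nonneg m k)
  rcases lt_trichotomy k L with hk | rfl | hk
  · rwa [tail_of_lt hk, zero_mul]
  · exact le_rfl
  · by_cases h : 0 < A L L
    · rw [tail_of_pos h hk.le, tail_of_pos h le_rfl]
      exact hA.row_dominates hL le_rfl hk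
    · rwa [tail_of_not_pos h, if_neg hk.ne', zero_mul]

lemma pos_of_tail_pos (hA : OrderedChain A) {m L k : Fin (n + 2)} (hL : 0 < A m L)
    (hk : 0 < tail A L k) : 0 < A m k :=
  pos_of_mul_pos_right ((mul_pos hk hL).trans_le (hA.tail_mul_le hL)) (tail_self_pos A L).le

lemma le_of_tail_pos {L k : Fin (n + 2)} (hk : 0 < tail A L k) : L ≤ k := by
  by_contra h
  rw [tail_of_lt (not_le.1 h)] at hk
  exact lt_irrefl _ hk

/-- The states below `L` in a row that charges `L`, and the states charged by `tail L`, lead to the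
states from `L` on in proportion to `tail L`. -/
lemma mul_tail_eq (hA : OrderedChain A) {m L j b : Fin (n + 2)} (hL : 0 < A m L)
    (hj : (j < L ∧ 0 < A m j) ∨ 0 < tail A L j) (hb : L ≤ b) :
    A j b * tail A L L = A j L * tail A L b := by
  by_cases h : 0 < A L L
  · rw [tail_of_pos h hb, tail_of_pos h le_rfl]
    rcases lt_trichotomy j L with hjL | rfl | hjL
    · exact hA.tail_eq hjL le_rfl hb
    · rw [mul_comm]
    · have hp : 0 < A L j := by
        rcases hj with hj | hj
        · exact absurd hj.1 hjL.asymm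
        · rwa [tail_of_pos h hjL.le] at hj
      linarith [hA.tail_proportional hjL hp le_rfl hb]
  · rcases hb.eq_or_lt with rfl | hb
    · rfl
    · have hz : A j b = 0 := by
        by_contra hne
        have hpos := lt_of_le_of_ne (hA.nonneg j b) (Ne.symm hne)
        refine h ?_
        rcases hj with hj | hj
        · exact hA.diag_pos_of_between hj.2 hL hj.1.le hb hpos
        · rw [tail_of_not_pos h] at hj
          have hjL : j = L := by
            by_contra hcon
            rw [if_neg hcon] at hj
            exact lt_irrefl _ hj
          subst hjL
          exact hA.diag_pos_of_between hL hL le_rfl hb hpos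
      rw [hz, tail_of_not_pos h b, if_neg hb.ne', zero_mul, mul_zero]

lemma tail_proportional_tail (hA : OrderedChain A) {m L k l : Fin (n + 2)}
    (hL : 0 < A m L) (hk : 0 < A m k) (hLk : L < k) (hkl : k ≤ l) :
    tail A L l * tail A k k = tail A L k * tail A k l := by
  rcases hkl.eq_or_lt with rfl | hkl
  · rfl
  by_cases h : 0 < A L L
  · rw [tail_of_pos h (hLk.le.trans hkl.le), tail_of_pos h hLk.le]
    by_cases h1 : 0 < A L k
    · have h2 := hA.diag_pos hLk h1
      rw [tail_of_pos h2 le_rfl, tail_of_pos h2 hkl.le]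
      exact (hA.tail_proportional hLk h1 hLk.le (hLk.le.trans hkl.le)).symm
    · have h3 := hA.eq_zero_of_not_pos h1
      have h4 : A L l = 0 := by
        by_contra hne
        have hpos := lt_of_le_of_ne (hA.nonneg L l) (Ne.symm hne)
        have := hA.row_dominates hL hLk.le hkl
        rw [h3, zero_mul] at this
        exact absurd this (not_le.2 (mul_pos hpos hk))
      rw [h3, h4, zero_mul, zero_mul]
  · rw [tail_of_not_pos h, tail_of_not_pos h, if_neg hLk.ne', if_neg (hLk.trans hkl).ne']
    ring

/-! ### Exit probabilities below and above a state -/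

lemma survival_mono (hA : OrderedChain A) {i k : Fin (n + 2)} (h : i ≤ k) :
    1 - A i 0 ≤ 1 - A k 0 := by linarith [hA.absorb_antitone h]

/-- For a row `z` without mass above `z`, the mean of `exit2` over the states below `L` is at most
its mean over `tail L`.

The part `X` of the row that consists of the states below `L` and of a multiple of `tail L` loses
mass in every transient state, and what it loses is, from `L` on, a multiple of `tail L`. The exit
probability of `X` is the survival probability of the lost mass. As survival probabilities increase
with the state, it is at most what the same loss would give under `tail L`. The total losses are compared by Chebyshev's inequality. -/
lemma headSum_exit2_le_tail (hA : OrderedChain A) {z L : Fin (n + 2)} (hz : ∀ j, z < j → A z j = 0)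
    (hL0 : L ≠ 0) (hL : 0 < A z L) :
    headSum L (fun j => A z j * exit2 A j) * ∑ k, tail A L k
      ≤ headSum L (A z) * ∑ k, tail A L k * exit2 A k := by
  set q := tail A L with hq
  have hq0 : ∀ k, 0 ≤ q k := hA.tail_nonneg L
  have hqL : 0 < q L := tail_self_pos A L
  have hL0' : 0 < L := Fin.pos_of_ne_zero hL0
  set X : Fin (n + 2) → ℝ := fun k => if k < L then q L * A z k else A z L * q k with hX
  have hXlt : ∀ {k}, k < L → X k = q L * A z k := fun {k} h => if_pos h
  have hXge : ∀ {k}, L ≤ k → X k = A z L * q k := fun {k} h => if_neg (not_lt.2 h)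
  have hX0 : ∀ k, 0 ≤ X k := fun k => by
    rcases lt_or_ge k L with h | h
    · rw [hXlt h]; exact mul_nonneg hqL.le (hA.nonneg z k)
    · rw [hXge h]; exact mul_nonneg hL.le (hq0 k)
  have hXle : ∀ k, X k ≤ q L * A z k := fun k => by
    rcases lt_or_ge k L with h | h
    · rw [hXlt h]
    · rw [hXge h, mul_comm]; exact hA.tail_mul_le hL
  have hXsupp : ∀ {j}, 0 < X j → (j < L ∧ 0 < A z j) ∨ 0 < q j := fun {j} h => by
    rcases lt_or_ge j L with hj | hj
    · rw [hXlt hj] at h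
      exact Or.inl ⟨hj, pos_of_mul_pos_right h hqL.le⟩
    · rw [hXge hj] at h
      exact Or.inr (pos_of_mul_pos_right h hL.le)
  have hsumX : ∀ g : Fin (n + 2) → ℝ, ∑ k, X k * g k
      = q L * headSum L (fun j => A z j * g j) + A z L * ∑ k, q k * g k := fun g => by
    rw [headSum_eq_sum_ite, Finset.mul_sum, Finset.mul_sum, ← Finset.sum_add_distrib]
    refine Finset.sum_congr rfl fun k _ => ?_
    by_cases h : k < L
    · rw [hXlt h, if_pos (Fin.lt_def.1 h), show q k = 0 from tail_of_lt h]; ring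
    · rw [hXge (not_lt.1 h), if_neg (fun h' => h (Fin.lt_def.2 h'))]; ring
  -- the loss of `X` in one step
  set y : Fin (n + 2) → ℝ := fun b => X b - ∑ j, X j * A j b with hy
  have hloss : ∀ b, b ≠ 0 → ∑ j, X j * A j b ≤ q L * A z b := fun b hb => by
    calc ∑ j, X j * A j b ≤ ∑ j, q L * (A z j * A j b) := Finset.sum_le_sum fun j _ => by
          rw [← mul_assoc]; exact mul_le_mul_of_nonneg_right (hXle j) (hA.nonneg j b)
      _ = q L * (A ^ 2) z b := by rw [← Finset.mul_sum, sq_apply]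
      _ ≤ q L * A z b := mul_le_mul_of_nonneg_left (hA.sq_le z hb) hqL.le
  have hylt : ∀ b, b ≠ 0 → b < L → 0 ≤ y b := fun b hb hbL => by
    have := hloss b hb
    simp only [hy, hXlt hbL]; linarith
  have hyL : 0 ≤ y L := by
    have := hloss L hL0
    simp only [hy, hXge le_rfl]; linarith
  have hyge : ∀ b, L ≤ b → y b * q L = y L * q b := fun b hb => by
    have h1 : (∑ j, X j * A j b) * q L = (∑ j, X j * A j L) * q b := by
      rw [Finset.sum_mul, Finset.sum_mul]
      refine Finset.sum_congr rfl fun j _ => ?_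
      rcases (hX0 j).eq_or_lt with h | h
      · simp [← h]
      · rw [mul_assoc, mul_assoc, hA.mul_tail_eq hL (hXsupp h) hb]
    simp only [hy, sub_mul, h1, hXge hb, hXge (le_refl L)]
    ring
  set R : Fin (n + 2) → ℝ := fun b => 1 - A b 0 with hR
  set K := ∑ k, q k with hK
  set S := ∑ k, q k * R k with hS
  set W := ∑ k, q k * exit2 A k with hW
  have hW0 : 0 ≤ W := Finset.sum_nonneg fun k _ => mul_nonneg (hq0 k) (hA.exit2_nonneg k)
  have hlow : ∀ b, b < L → R b * K ≤ S := fun b hb => by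
    rw [hK, hS, Finset.mul_sum]
    refine Finset.sum_le_sum fun k _ => ?_
    rcases lt_or_ge k L with h | h
    · simp [hq, tail_of_lt h]
    · rw [mul_comm]
      exact mul_le_mul_of_nonneg_left (hA.survival_mono (hb.le.trans h)) (hq0 k)
  -- the loss survives one more step no better than `tail L`
  have hstep1 : (∑ b, y b * R b) * K ≤ S * ∑ b, if b = 0 then 0 else y b := by
    have h2 : (∑ b, y b * (R b * K - S)) - y 0 * (R 0 * K - S) ≤ 0 := by
      rw [← sum_ite_eq_zero]
      have hq2 : ∑ b, y L * (q b * (R b * K - S)) = 0 := by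
        rw [← Finset.mul_sum]
        have : ∑ b, q b * (R b * K - S) = 0 := by
          simp only [mul_sub, Finset.sum_sub_distrib, ← mul_assoc, ← Finset.sum_mul]
          rw [← hS, ← hK]; ring
        rw [this, mul_zero]
      have h3 : ∑ b, q L * (if b = 0 then 0 else y b * (R b * K - S)) ≤ 0 := by
        refine (Finset.sum_le_sum fun b _ => ?_).trans_eq hq2
        split_ifs with hb
        · rw [hb, show q 0 = 0 from tail_of_lt hL0']; simp
        · rcases lt_or_ge b L with h | h
          · rw [show q b = 0 from tail_of_lt h, zero_mul, mul_zero]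
            exact mul_nonpos_of_nonneg_of_nonpos hqL.le
              (mul_nonpos_of_nonneg_of_nonpos (hylt b hb h) (by linarith [hlow b h]))
          · have := hyge b h
            apply le_of_eq
            calc q L * (y b * (R b * K - S)) = (y b * q L) * (R b * K - S) := by ring
              _ = y L * (q b * (R b * K - S)) := by rw [this]; ring
      rw [← Finset.mul_sum] at h3
      exact nonpos_of_mul_nonpos_right h3 hqL
    have hR00 : R 0 = 0 := by simp [hR, hA.absorbing]
    rw [sum_ite_eq_zero]
    simp only [mul_sub, Finset.sum_sub_distrib, ← mul_assoc, ← Finset.sum_mul] at h2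
    rw [hR00] at h2
    linarith
  have hXw : ∑ k, X k * exit2 A k = ∑ b, y b * R b := by
    simp only [hy, sub_mul, Finset.sum_sub_distrib, Finset.sum_mul, hA.exit2_eq_sub, mul_sub,
      Finset.mul_sum]
    rw [Finset.sum_comm (f := fun b j => X j * A j b * R b)]
    simp only [mul_assoc, hR, mul_sub, Finset.sum_sub_distrib]
  have hyXa : (∑ b, if b = 0 then 0 else y b) = ∑ b, if b = 0 then 0 else X b * A b 0 := by
    rw [sum_ite_eq_zero, sum_ite_eq_zero, hA.absorbing]
    simp only [hy, Finset.sum_sub_distrib]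
    rw [Finset.sum_comm]
    simp only [← Finset.mul_sum, hA.row_sum, mul_one]
    ring
  -- the row of `z` dominates `tail L` after one step
  set η : Fin (n + 2) → ℝ := fun b => ∑ c, q c * A c b with hη
  have hmlr : ∀ j k, j < k → X j * η k ≤ X k * η j := fun j k hjk => by
    simp only [hη, Finset.mul_sum]
    refine Finset.sum_le_sum fun c _ => ?_
    rcases (hq0 c).eq_or_lt with h | hc
    · simp [← h]
    have hcz : c ≤ z := by
      by_contra hcon
      exact (hA.pos_of_tail_pos hL hc).ne' (hz c (not_le.1 hcon))
    have hmin : ∀ j k, j < k → A z j * A c k ≤ A z k * A c j := fun j k hjk => by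
      rcases hcz.eq_or_lt with rfl | h
      · rw [mul_comm]
      · linarith [hA.minor h hjk]
    have key : X j * A c k ≤ X k * A c j := by
      rcases lt_or_ge k L with hk | hk
      · rw [hXlt (hjk.trans hk), hXlt hk, mul_assoc, mul_assoc]
        exact mul_le_mul_of_nonneg_left (hmin j k hjk) hqL.le
      · have hck := hA.mul_tail_eq hL (Or.inr hc) hk
        rw [← hq] at hck
        rcases lt_or_ge j L with hj | hj
        · rw [hXlt hj, hXge hk]
          calc q L * A z j * A c k = A z j * (A c k * q L) := by ring
            _ = q k * (A z j * A c L) := by rw [hck]; ring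
            _ ≤ q k * (A z L * A c j) := mul_le_mul_of_nonneg_left (hmin j L hj) (hq0 k)
            _ = A z L * q k * A c j := by ring
        · have hcj := hA.mul_tail_eq hL (Or.inr hc) hj
          rw [← hq] at hcj
          rw [hXge hj, hXge hk]
          refine le_of_mul_le_mul_right (le_of_eq ?_) hqL
          calc A z L * q j * A c k * q L = A z L * q j * (A c k * q L) := by ring
            _ = A z L * q k * (A c j * q L) := by rw [hck, hcj]; ring
            _ = A z L * q k * A c j * q L := by ring
    nlinarith
  have hstep2 : (∑ b, if b = 0 then 0 else X b * A b 0) * S ≤ (∑ b, X b) * W := by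
    have h := sum_mul_sum_le_of_mlr (x := fun b => if b = 0 then 0 else X b)
      (η := fun b => if b = 0 then 0 else η b) hA.absorb_antitone (fun j k hjk => by
        by_cases hj : j = 0
        · simp [hj]
        · rw [if_neg hj, if_neg hj, if_neg (fun hk => ?_), if_neg (fun hk => ?_)]
          · exact hmlr j k hjk
          all_goals
            rw [hk] at hjk
            exact absurd hjk (Fin.not_lt_zero j))
    have e1 : (∑ b, if b = 0 then 0 else η b) = S := by
      rw [sum_ite_eq_zero]
      simp only [hη, hS, hR, mul_sub, mul_one, Finset.sum_sub_distrib]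
      rw [Finset.sum_comm]
      simp only [← Finset.mul_sum, hA.row_sum, mul_one]
    have e2 : (∑ b, (if b = 0 then 0 else η b) * A b 0) = W := by
      simp only [hW, hA.exit2_eq, Finset.mul_sum, ite_mul, zero_mul, hη, Finset.sum_mul]
      rw [Finset.sum_comm]
      refine Finset.sum_congr rfl fun b _ => ?_
      by_cases hb : b = 0
      · simp [hb]
      · simp only [if_neg hb, mul_assoc]
    simp only [ite_mul, zero_mul] at h e2
    rw [e1, e2] at h
    refine h.trans (mul_le_mul_of_nonneg_right (Finset.sum_le_sum fun b _ => ?_) hW0)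
    split_ifs
    · exact hX0 b
    · exact le_rfl
  have hfin : (∑ k, X k * exit2 A k) * K ≤ (∑ b, X b) * W := by
    rw [hXw]; refine hstep1.trans ?_; rw [hyXa, mul_comm]; exact hstep2
  have e3 : ∑ b, X b = q L * headSum L (A z) + A z L * K := by
    simpa using hsumX fun _ => 1
  rw [hsumX, e3, ← hW] at hfin
  refine le_of_mul_le_mul_left ?_ hqL
  linarith

/-- Along the support of a row, the sign of the mean of `g` over `tail L` propagates upwards: if it
is nonnegative whenever the sum of `x * g` over the states from `J` to `L`, completed by a multiple
of `tail L`, is nonnegative, then it is nonnegative throughout. -/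
lemma tail_chain (hA : OrderedChain A) (m : Fin (n + 2)) (g : Fin (n + 2) → ℝ) {J : ℕ}
    (hJ : J ≤ n + 2)
    (H : ∀ L : Fin (n + 2), J ≤ (L : ℕ) → 0 < A m L → ∀ β : ℝ, 0 ≤ β →
      0 ≤ headSum L (fun j => A m j * g j) - headSum J (fun j => A m j * g j)
        + β * ∑ k, tail A L k * g k → 0 ≤ ∑ k, tail A L k * g k) :
    headSum J (fun j => A m j * g j) ≤ ∑ j, A m j * g j ∧
      ∀ L : Fin (n + 2), J ≤ (L : ℕ) → 0 < A m L → 0 ≤ ∑ k, tail A L k * g k := by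
  set x := A m
  set F : ℕ → ℝ := fun l => headSum l (fun j => x j * g j) with hF
  set P : ℕ → (Fin (n + 2) → ℝ) → Prop := fun l τ =>
    (∀ k : Fin (n + 2), (k : ℕ) < l → τ k = 0) ∧ (∀ k, 0 ≤ τ k) ∧ (∀ k, τ k ≤ x k) ∧
      0 ≤ F l - F J + ∑ k, τ k * g k ∧
      ∀ k k' : Fin (n + 2), l ≤ (k : ℕ) → k ≤ k' → 0 < x k →
        τ k' * tail A k k = τ k * tail A k k' with hP
  have step : ∀ L : Fin (n + 2), J ≤ (L : ℕ) → 0 < x L → ∀ τ, P L τ →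
      ∃ β, 0 ≤ β ∧ β * tail A L L ≤ x L ∧ (∑ k, τ k * g k) = β * ∑ k, tail A L k * g k := by
    intro L _ hxL τ hτ
    have hLL := tail_self_pos A L
    refine ⟨τ L / tail A L L, div_nonneg (hτ.2.1 L) hLL.le, ?_, ?_⟩
    · rw [div_mul_cancel₀ _ hLL.ne']; exact hτ.2.2.1 L
    · rw [Finset.mul_sum]
      refine Finset.sum_congr rfl fun k _ => ?_
      rcases lt_or_ge k L with h | h
      · rw [tail_of_lt h, hτ.1 k h]; ring
      · have := hτ.2.2.2.2 L k le_rfl h hxL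
        field_simp
        linear_combination g k * this
  have main : ∀ l, J ≤ l → l ≤ n + 2 → ∃ τ, P l τ := by
    intro l hl
    induction l, hl using Nat.le_induction with
    | base =>
      intro _
      exact ⟨0, by simp, by simp, fun k => hA.nonneg m k, by simp, by simp⟩
    | succ l hl ih =>
      intro hln
      obtain ⟨τ, hτ⟩ := ih (by omega)
      set L : Fin (n + 2) := ⟨l, by omega⟩ with hLdef
      have hFs : F (l + 1) = F l + x L * g L := headSum_succ _ L
      rcases (hA.nonneg m L).eq_or_lt with hx0 | hxL
      · refine ⟨τ, fun k hk => ?_, hτ.2.1, hτ.2.2.1, ?_, fun k k' hk => hτ.2.2.2.2 k k' (by omega)⟩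
        · rcases (Nat.lt_succ_iff.1 hk).lt_or_eq with h | h
          · exact hτ.1 k h
          · have : k = L := Fin.ext h
            have h1 := hτ.2.1 k
            have h2 := hτ.2.2.1 k
            rw [this] at h1 h2 ⊢
            exact le_antisymm (h2.trans hx0.ge) h1
        · rw [hFs, show x L = 0 from hx0.symm, zero_mul, add_zero]
          exact hτ.2.2.2.1
      · obtain ⟨β, hβ, hβx, hβg⟩ := step L hl hxL τ hτ
        have h1 := hτ.2.2.2.1
        rw [hβg] at h1
        have hg := H L hl hxL β hβ h1
        have hLL := tail_self_pos A L
        set ξ := x L / tail A L L with hξ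
        have hξ0 : 0 ≤ ξ := div_nonneg hxL.le hLL.le
        have hξL : ξ * tail A L L = x L := div_mul_cancel₀ _ hLL.ne'
        have hβξ : β ≤ ξ := (le_div_iff₀ hLL).2 hβx
        refine ⟨fun k => if k = L then 0 else ξ * tail A L k, fun k hk => ?_, fun k => ?_,
          fun k => ?_, ?_, fun k k' hk hkk' hxk => ?_⟩
        · dsimp only
          split_ifs with h
          · rfl
          · have hkL : k < L := by
              refine lt_of_le_of_ne ?_ h
              rw [Fin.le_def]; exact Nat.lt_succ_iff.1 hk
            rw [tail_of_lt hkL, mul_zero]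
        · dsimp only
          split_ifs
          · exact le_rfl
          · exact mul_nonneg hξ0 (hA.tail_nonneg L k)
        · dsimp only
          split_ifs
          · exact hA.nonneg m k
          · refine le_of_mul_le_mul_right ?_ hLL
            calc ξ * tail A L k * tail A L L = tail A L k * (ξ * tail A L L) := by ring
              _ = tail A L k * A m L := by rw [hξL]
              _ ≤ tail A L L * A m k := hA.tail_mul_le hxL
              _ = A m k * tail A L L := mul_comm _ _
        · have e : (∑ k, (if k = L then 0 else ξ * tail A L k) * g k)
              = ξ * (∑ k, tail A L k * g k) - x L * g L := by
            have e1 : ∀ k, (if k = L then 0 else ξ * tail A L k) * g k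
                = ξ * (tail A L k * g k) - if k = L then ξ * tail A L L * g L else 0 := by
              intro k
              split_ifs with h
              · rw [h]; ring
              · ring
            simp only [e1, Finset.sum_sub_distrib, Finset.sum_ite_eq', Finset.mem_univ, if_true,
              hξL, ← Finset.mul_sum]
          rw [e, hFs]
          nlinarith
        · have hLk : L < k := by rw [Fin.lt_def]; exact hk
          dsimp only
          rw [if_neg hLk.ne', if_neg (hLk.trans_le hkk').ne', mul_assoc, mul_assoc,
            hA.tail_proportional_tail hxL hxk hLk hkk']
  constructor
  · obtain ⟨τ, hτ⟩ := main (n + 2) hJ le_rfl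
    have h := hτ.2.2.2.1
    have hz : ∑ k, τ k * g k = 0 := Finset.sum_eq_zero fun k _ => by rw [hτ.1 k k.2, zero_mul]
    rw [hz, hF] at h
    simp only [headSum_all] at h
    linarith
  · intro L hL hxL
    obtain ⟨τ, hτ⟩ := main L hL L.2.le
    obtain ⟨β, hβ, -, hβg⟩ := step L hL hxL τ hτ
    have h1 := hτ.2.2.2.1
    rw [hβg] at h1
    exact H L hL hxL β hβ h1

lemma sum_tail_mul_sub (A : Matrix (Fin (n + 2)) (Fin (n + 2)) ℝ) (L : Fin (n + 2)) (s t : ℝ) :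
    ∑ k, tail A L k * (exit2 A k * s - t)
      = (∑ k, tail A L k * exit2 A k) * s - (∑ k, tail A L k) * t := by
  simp only [Finset.sum_mul, ← Finset.sum_sub_distrib]
  exact Finset.sum_congr rfl fun k _ => by ring

/-- As `headSum_exit2_le_tail`, with the mean over the states below any `J ≤ L`. -/
lemma headSum_exit2_le_tail_of_le (hA : OrderedChain A) {z L : Fin (n + 2)}
    (hz : ∀ j, z < j → A z j = 0) (hL : 0 < A z L) {J : ℕ} (hJ : J ≤ (L : ℕ)) :
    headSum J (fun j => A z j * exit2 A j) * ∑ k, tail A L k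
      ≤ headSum J (A z) * ∑ k, tail A L k * exit2 A k := by
  set s := headSum J (A z) with hs
  set c := headSum J (fun j => A z j * exit2 A j) with hc
  have hs0 : 0 ≤ s := headSum_nonneg (hA.nonneg z) J
  rcases hs0.eq_or_lt with h0 | hspos
  · have : c = 0 := headSum_eq_zero fun j hj => by
      rw [eq_zero_of_headSum_eq_zero (hA.nonneg z) h0.symm hj, zero_mul]
    rw [this, ← h0, zero_mul, zero_mul]
  -- `g` is the deviation of `exit2` from its mean below `J`, cleared of the denominator
  have hJc : headSum J (fun j => A z j * (exit2 A j * s - c)) = 0 := by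
    rw [headSum_sub_mul, ← hs, ← hc]; ring
  have h := (hA.tail_chain z (fun j => exit2 A j * s - c) (J := J) (by omega) ?_).2 L hJ hL
  · rw [sum_tail_mul_sub] at h
    linarith
  · intro L' hJL' hL' β hβ h
    by_contra hneg
    rw [not_le] at hneg
    have hL'0 : L' ≠ 0 := by
      rintro rfl
      have : J = 0 := by simpa using hJL'
      rw [this, headSum_zero] at hs
      exact hspos.ne' hs
    have hK := hA.headSum_exit2_le_tail hz hL'0 hL'
    have hmono : s ≤ headSum L' (A z) :=
      Finset.sum_le_sum_of_subset_of_nonneg (fun j hj => by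
        simp only [Finset.mem_filter, Finset.mem_univ, true_and] at hj ⊢
        omega) fun j _ _ => hA.nonneg z j
    rw [hJc, sub_zero, headSum_sub_mul] at h
    rw [sum_tail_mul_sub] at h hneg
    have hq := hA.sum_tail_pos L'
    set a := headSum L' (fun j => A z j * exit2 A j)
    set b := headSum L' (A z)
    set W := ∑ k, tail A L' k * exit2 A k
    set K := ∑ k, tail A L' k
    have h1 : 0 ≤ a * s - b * c := by nlinarith
    have h2 : (a * s - b * c) * K ≤ b * (W * s - K * c) := by nlinarith
    have h3 : b * (W * s - K * c) < 0 := mul_neg_of_pos_of_neg (hspos.trans_le hmono) hneg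
    nlinarith [mul_nonneg h1 hq.le]

/-! ### Rows that do not reach the target at once -/

/-- A transient state from which the target is not reached within two steps cannot be kept. -/
lemma diag_eq_zero_of_not_absorbed (hA : OrderedChain A) {c : Fin (n + 2)} (hc : c ≠ 0)
    (h1 : A c 0 = 0) (h2 : (A ^ 2) c 0 = 0) : A c c = 0 := by
  have hrow2 : ∑ j, (A ^ 2) c j = 1 := by
    simp only [sq_apply]
    rw [Finset.sum_comm]
    simp only [← Finset.mul_sum, hA.row_sum, mul_one]
  have hle : ∀ j, (A ^ 2) c j ≤ A c j := fun j => by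
    rcases eq_or_ne j 0 with rfl | hj
    · rw [h1, h2]
    · exact hA.sq_le c hj
  have heq : ∀ j, (A ^ 2) c j = A c j := fun j =>
    (Finset.sum_eq_sum_iff_of_le fun j _ => hle j).1 (by rw [hrow2, hA.row_sum]) j
      (Finset.mem_univ j)
  have hpow : ∀ k : ℕ, ∀ j, (A ^ (k + 1)) c j = A c j := by
    intro k
    induction k with
    | zero => intro j; rw [zero_add, pow_one]
    | succ k ih =>
      intro j
      rw [pow_succ, Matrix.mul_apply]
      simp only [ih]
      rw [← sq_apply, heq]
  have hlim := (hA.transient c hc).tendsto_atTop_zero.comp (Filter.tendsto_add_atTop_nat 1)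
  have hconst : ((fun k : ℕ => (A ^ k) c c) ∘ fun k => k + 1) = fun _ => A c c := by
    funext k; exact hpow k c
  rw [hconst] at hlim
  exact tendsto_nhds_unique tendsto_const_nhds hlim

lemma absorb_pos_of_least (hA : OrderedChain A) {z h : Fin (n + 2)} (hh : 0 < A z h)
    (hmin : ∀ k < h, A z k = 0) (h0 : h ≠ 0) : 0 < A h 0 := by
  by_contra hcon
  have hz0 := hA.eq_zero_of_not_pos hcon
  have hsupp : ∀ j, 0 < A h j → h ≤ j := fun j hj => by
    by_contra hlt
    rcases eq_or_ne j 0 with rfl | hj0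
    · exact hcon hj
    · exact (hA.pos_trans hj0 hh hj).ne' (hmin j (not_le.1 hlt))
  have hz : ∀ j, h ≤ j → A j 0 = 0 := fun j hj =>
    le_antisymm (hz0 ▸ hA.absorb_antitone hj) (hA.nonneg j 0)
  have hdiag : ∀ b, h ≤ b → (b = h ∨ 0 < A h b) → A b b = 0 := by
    intro b hb hbh
    have hb0 : b ≠ 0 := ((Fin.pos_of_ne_zero h0).trans_le hb).ne'
    refine hA.diag_eq_zero_of_not_absorbed hb0 (hz b hb) ?_
    rw [sq_apply]
    refine Finset.sum_eq_zero fun l _ => ?_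
    rcases (hA.nonneg b l).eq_or_lt with hbl | hbl
    · rw [← hbl, zero_mul]
    · have hl0 : l ≠ 0 := by
        rintro rfl
        exact hbl.ne' (hz b hb)
      have : 0 < A h l := by
        rcases hbh with rfl | hbh
        · exact hbl
        · exact hA.pos_trans hl0 hbh hbl
      rw [hz l (hsupp l this), mul_zero]
  obtain ⟨b, hb⟩ := hA.exists_pos h
  rcases (hsupp b hb).eq_or_lt with rfl | hlt
  · exact hb.ne' (hdiag h le_rfl (Or.inl rfl))
  · exact (hA.diag_pos hlt hb).ne' (hdiag b hlt.le (Or.inr hb))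

/-- If a row starts at `h ≥ 1`, the states up to `h` and those entered from `h` have, on the
transient states, rows supported from `h` on. -/
lemma eq_zero_of_lt_least (hA : OrderedChain A) {z h c j : Fin (n + 2)} (hh : 0 < A z h)
    (hmin : ∀ k < h, A z k = 0) (hc : c ≤ h ∨ 0 < A h c) (hj : j ≠ 0) (hjh : j < h) :
    A c j = 0 := by
  have h0 : h ≠ 0 := ((Fin.pos_of_ne_zero hj).trans hjh).ne'
  have key : ¬ 0 < A h j := fun hpos => (hA.pos_trans hj hh hpos).ne' (hmin j hjh)
  by_contra hne
  have hpos : 0 < A c j := lt_of_le_of_ne (hA.nonneg c j) (Ne.symm hne)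
  rcases hc with hc | hc
  · rcases hc.eq_or_lt with rfl | hc
    · exact key hpos
    · have := hA.minor hc (Fin.pos_of_ne_zero hj)
      rw [hA.eq_zero_of_not_pos key, mul_zero] at this
      exact absurd this (not_le.2 (mul_pos hpos (hA.absorb_pos_of_least hh hmin h0)))
  · exact key (hA.pos_trans hj hc hpos)

/-- If a row starts at `h`, then on the states up to `h` and those entered from `h` the
probabilities of absorption at time two are proportional to the survival probabilities. -/
lemma exit2_mul_surv (hA : OrderedChain A) {z h c : Fin (n + 2)} (hh : 0 < A z h)
    (hmin : ∀ k < h, A z k = 0) (hc : c ≤ h ∨ 0 < A h c) :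
    exit2 A c * (1 - A h 0) = (1 - A c 0) * exit2 A h := by
  have hprop : ∀ b b', b ≠ 0 → b' ≠ 0 → A c b * A h b' = A c b' * A h b := by
    intro b b' hb hb'
    rcases lt_or_ge b h with hbh | hbh
    · rw [hA.eq_zero_of_lt_least hh hmin hc hb hbh,
        hA.eq_zero_of_lt_least hh hmin (Or.inl le_rfl) hb hbh, zero_mul, mul_zero]
    · rcases lt_or_ge b' h with hbh' | hbh'
      · rw [hA.eq_zero_of_lt_least hh hmin hc hb' hbh',
          hA.eq_zero_of_lt_least hh hmin (Or.inl le_rfl) hb' hbh', zero_mul, mul_zero]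
      · rcases lt_trichotomy c h with hch | rfl | hch
        · linarith [hA.tail_eq hch hbh hbh']
        · ring
        · have hpos : 0 < A h c := hc.resolve_left (not_le.2 hch)
          linarith [hA.tail_proportional hch hpos hbh hbh']
  rw [hA.exit2_eq, hA.exit2_eq, hA.surv_eq, hA.surv_eq, Finset.sum_mul_sum, Finset.sum_mul_sum]
  rw [Finset.sum_comm]
  refine Finset.sum_congr rfl fun b' _ => Finset.sum_congr rfl fun b _ => ?_
  split_ifs with hb hb'
  · ring
  · ring
  · ring
  · linear_combination A b 0 * hprop b b' hb (by assumption)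

lemma exit2_le_of_le_least (hA : OrderedChain A) {z h c c' : Fin (n + 2)} (hh : 0 < A z h)
    (hmin : ∀ k < h, A z k = 0) (hc : c ≤ h) (hc' : c' ≤ h ∨ 0 < A h c') (hcc : c ≤ c') :
    exit2 A c ≤ exit2 A c' := by
  have hR := hA.survival_mono hcc
  have hRh : 0 ≤ 1 - A h 0 := by linarith [hA.le_one h 0]
  rcases hRh.eq_or_lt with h0 | hpos
  · linarith [hA.exit2_le c, hA.survival_mono hc, hA.exit2_nonneg c']
  · refine le_of_mul_le_mul_right ?_ hpos
    rw [hA.exit2_mul_surv hh hmin (Or.inl hc), hA.exit2_mul_surv hh hmin hc']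
    exact mul_le_mul_of_nonneg_right hR (hA.exit2_nonneg h)

/-! ### The exit probability is increasing after one step -/

lemma exists_least_pos (hA : OrderedChain A) (z : Fin (n + 2)) :
    ∃ h, 0 < A z h ∧ ∀ k < h, A z k = 0 := by
  obtain ⟨h, hh, hmin⟩ := WellFounded.has_min (wellFounded_lt (α := Fin (n + 2)))
    {j | 0 < A z j} (hA.exists_pos z)
  exact ⟨h, hh, fun k hk => hA.eq_zero_of_not_pos fun hp => hmin k hp hk⟩

lemma lt_least {z j h : Fin (n + 2)} (hh : 0 < A z h) (hj : ∀ k ≤ j, A z k = 0) : j < h := by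
  by_contra hcon
  exact hh.ne' (hj h (not_lt.1 hcon))

/-- The highest state that can be reached from `m`, or `m` itself if that is higher. -/
lemma exists_top (hA : OrderedChain A) (m : Fin (n + 2)) :
    ∃ z, m ≤ z ∧ (z = m ∨ 0 < A m z) ∧ ∀ j, z < j → A z j = 0 := by
  obtain ⟨z, hz, hmax⟩ := WellFounded.has_min (wellFounded_gt (α := Fin (n + 2)))
    {j | m ≤ j ∧ (j = m ∨ 0 < A m j)} ⟨m, le_rfl, Or.inl rfl⟩
  refine ⟨z, hz.1, hz.2, fun j hj => hA.eq_zero_of_not_pos fun hpos => ?_⟩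
  refine hmax j ⟨hz.1.trans hj.le, Or.inr ?_⟩ hj
  rcases hz.2 with rfl | hmz
  · exact hpos
  · exact hA.pos_trans (Fin.pos_of_ne_zero (fun h => by simp [h] at hj)).ne' hmz hpos

/-- `headSum_exit2_le_tail_of_le` for every row, by comparison with the row of the highest state
that it reaches. -/
lemma headSum_exit2_le_tail_row (hA : OrderedChain A) {m L : Fin (n + 2)} (hL0 : L ≠ 0)
    (hL : 0 < A m L) {J : ℕ} (hJ : J ≤ (L : ℕ)) :
    headSum J (fun j => A m j * exit2 A j) * ∑ k, tail A L k
      ≤ headSum J (A m) * ∑ k, tail A L k * exit2 A k := by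
  obtain ⟨z, hmz, hz, hztop⟩ := hA.exists_top m
  obtain ⟨h, hh, hmin⟩ := hA.exists_least_pos z
  set W := ∑ k, tail A L k * exit2 A k with hW
  set K := ∑ k, tail A L k with hK
  have hK0 : 0 < K := hA.sum_tail_pos L
  have hrow : ∀ j k, j < k → A m k * A z j ≤ A m j * A z k := fun j k hjk => by
    rcases hmz.eq_or_lt with rfl | hlt
    · rw [mul_comm]
    · exact hA.minor hlt hjk
  by_cases hLz : 0 < A z L
  · have := headSum_mul_nonpos (x := A z) (p := A m) (g := fun j => exit2 A j * K - W) (J := J)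
      (hA.nonneg z) (hA.nonneg m) hrow (by omega) (fun J' hJ' => ?_) (fun j hj hlow => ?_)
    · rw [headSum_sub_mul] at this
      linarith
    · rw [headSum_sub_mul]
      linarith [hA.headSum_exit2_le_tail_of_le hztop hLz (hJ'.trans hJ)]
    · have hjh := lt_least hh hlow
      have h0 : h ≠ 0 := ((Fin.zero_le j).trans_lt hjh).ne'
      have hhL : h ≤ L := by
        by_contra hcon
        exact hLz.ne' (hmin L (not_le.1 hcon))
      have hjle : exit2 A j ≤ exit2 A h :=
        hA.exit2_le_of_le_least hh hmin hjh.le (Or.inl le_rfl) hjh.le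
      suffices exit2 A h * K ≤ W by nlinarith
      rcases hhL.eq_or_lt with rfl | hlt
      · rw [hK, hW, Finset.mul_sum]
        refine Finset.sum_le_sum fun k _ => ?_
        rcases (hA.tail_nonneg h k).eq_or_lt with h1 | h1
        · simp [← h1]
        · rw [mul_comm]
          refine mul_le_mul_of_nonneg_left ?_ h1.le
          refine hA.exit2_le_of_le_least hh hmin le_rfl ?_ (le_of_tail_pos h1)
          by_cases hd : 0 < A h h
          · rw [tail_of_pos hd (le_of_tail_pos h1)] at h1
            exact Or.inr h1
          · rw [tail_of_not_pos hd] at h1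
            left
            by_contra hcon
            rw [if_neg (not_le.1 hcon).ne'] at h1
            exact lt_irrefl _ h1
      · have h2 := hA.headSum_exit2_le_tail_of_le hztop hLz (J := h + 1) hlt
        have e : ∀ g : Fin (n + 2) → ℝ, headSum (h + 1) (fun j => A z j * g j) = A z h * g h := by
          intro g
          rw [headSum_succ, headSum_eq_zero, zero_add]
          intro j hj
          rw [hmin j hj, zero_mul]
        have e1 : headSum (h + 1) (A z) = A z h := by simpa using e fun _ => 1
        rw [e, e1, mul_assoc] at h2
        exact le_of_mul_le_mul_left h2 hh
  · -- the row of `z` starts above `L`, and `exit2` is increasing below its start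
    have hLz0 := hA.eq_zero_of_not_pos hLz
    have hmz' : 0 < A m z := by
      rcases hz with rfl | hz
      · exact absurd hL hLz
      · exact hz
    have hlow : ∀ k ≤ L, A z k = 0 := by
      intro k hk
      rcases hk.eq_or_lt with rfl | hk
      · exact hLz0
      · have := hrow k L hk
        rw [hLz0, mul_zero] at this
        by_contra hne
        exact absurd this (not_le.2 (mul_pos hL (lt_of_le_of_ne (hA.nonneg z k) (Ne.symm hne))))
    have hLh := lt_least hh hlow
    have hd : ¬ 0 < A L L := fun hd =>
      hd.ne' (hA.eq_zero_of_lt_least hh hmin (Or.inl hLh.le) hL0 hLh)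
    have hK1 : K = 1 := by simp [hK, tail_of_not_pos hd]
    have hW1 : W = exit2 A L := by simp [hW, tail_of_not_pos hd]
    rw [hK1, hW1, mul_one, headSum, headSum, Finset.sum_mul]
    refine Finset.sum_le_sum fun j hj => mul_le_mul_of_nonneg_left ?_ (hA.nonneg m j)
    have hjL : j < L := by
      rw [Fin.lt_def]
      exact (Finset.mem_filter.1 hj).2.trans_le hJ
    exact hA.exit2_le_of_le_least hh hmin (hjL.trans hLh).le (Or.inl hLh.le) hjL.le

/-- The mean of `exit2` over the states below `J` is at most its mean over the whole row. -/
lemma headSum_exit2_le (hA : OrderedChain A) (m : Fin (n + 2)) {J : ℕ} (hJ : J ≤ n + 2) :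
    headSum J (fun j => A m j * (exit2 A j - ∑ k, A m k * exit2 A k)) ≤ 0 := by
  set t := ∑ k, A m k * exit2 A k with ht
  by_contra hpos
  rw [not_le] at hpos
  have htot : ∑ j, A m j * (exit2 A j - t) = 0 := by
    simp only [mul_sub, Finset.sum_sub_distrib, ← Finset.sum_mul, hA.row_sum]
    rw [← ht]; ring
  have h := (hA.tail_chain m (fun j => exit2 A j - t) hJ ?_).1
  · rw [htot] at h
    exact absurd h (not_le.2 hpos)
  · intro L hJL hL β hβ h
    by_contra hneg
    rw [not_le] at hneg
    have hL0 : L ≠ 0 := by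
      rintro rfl
      have : J = 0 := by simpa using hJL
      rw [this, headSum_zero] at hpos
      exact lt_irrefl _ hpos
    have hrow := hA.headSum_exit2_le_tail_row hL0 hL le_rfl
    have e1 := headSum_sub_mul L (A m) (exit2 A) 1 t
    have e2 := sum_tail_mul_sub A L 1 t
    simp only [mul_one] at e1 e2
    rw [e1] at h
    rw [e2] at h hneg
    have hK := hA.sum_tail_pos L
    have hx : 0 ≤ headSum L (A m) := headSum_nonneg (hA.nonneg m) L
    set a := headSum L (fun j => A m j * exit2 A j)
    set b := headSum L (A m)
    set W := ∑ k, tail A L k * exit2 A k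
    set K := ∑ k, tail A L k
    have h1 : 0 < a - b * t := by nlinarith
    nlinarith [mul_pos h1 hK, mul_nonneg hx (neg_nonneg.2 hneg.le)]

/-- The probability of absorption at time three exactly is increasing in the initial state. -/
lemma sum_mul_exit2_mono (hA : OrderedChain A) :
    Monotone fun i => ∑ j, A i j * exit2 A j := by
  refine monotone_iff_forall_lt.2 fun i m him => ?_
  set t := ∑ k, A m k * exit2 A k with ht
  have h := headSum_mul_nonpos (x := A m) (p := A i) (g := fun j => exit2 A j - t) (J := n + 2)
      (hA.nonneg m) (hA.nonneg i) (fun j k hjk => hA.minor him hjk) le_rfl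
      (fun J' hJ' => hA.headSum_exit2_le m hJ') (fun j _ hlow => ?_)
  · rw [headSum_all] at h
    simp only [mul_sub, Finset.sum_sub_distrib, ← Finset.sum_mul, hA.row_sum, one_mul] at h
    linarith
  · obtain ⟨h, hh, hmin⟩ := hA.exists_least_pos m
    have hjh := lt_least hh hlow
    have h1 := hA.exit2_le_of_le_least hh hmin hjh.le (Or.inl le_rfl) hjh.le
    have h2 := hA.headSum_exit2_le m (J := h + 1) h.2
    rw [headSum_succ, headSum_eq_zero (fun j hj => by rw [hmin j hj, zero_mul]), zero_add,
      ← ht] at h2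
    have := nonpos_of_mul_nonpos_right h2 hh
    linarith

/-! ### Absorption probabilities over longer horizons -/

lemma monotone_mulVec (hA : OrderedChain A) {g : Fin (n + 2) → ℝ} (hg : Monotone g) :
    Monotone fun i => ∑ j, A i j * g j := by
  refine monotone_iff_forall_lt.2 fun i m him => ?_
  have := sum_mul_sum_le_of_mlr (x := A m) (η := A i) (a := fun j => - g j)
    (fun j k hjk => neg_le_neg (hg hjk)) (fun j k hjk => by linarith [hA.minor him hjk])
  simp only [hA.row_sum, mul_neg, Finset.sum_neg_distrib, mul_one, one_mul] at this
  linarith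

lemma pow_succ_apply (A : Matrix (Fin (n + 2)) (Fin (n + 2)) ℝ) (l : ℕ) (i j : Fin (n + 2)) :
    (A ^ (l + 1)) i j = ∑ k, A i k * (A ^ l) k j := by
  rw [pow_succ', Matrix.mul_apply]

lemma pow_absorb_antitone (hA : OrderedChain A) (l : ℕ) : Antitone fun i => (A ^ l) i 0 := by
  induction l with
  | zero =>
    intro i k hik
    simp only [pow_zero, Matrix.one_apply]
    split_ifs with h1 h2
    · exact le_rfl
    · rw [h1] at hik; exact absurd (le_antisymm hik (Fin.zero_le i)) h2
    · norm_num
    · exact le_rfl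
  | succ l ih =>
    have h := hA.monotone_mulVec (g := fun i => -(A ^ l) i 0) fun i k hik => neg_le_neg (ih hik)
    intro i k hik
    have := h hik
    simp only [mul_neg, Finset.sum_neg_distrib, ← pow_succ_apply] at this
    exact neg_le_neg_iff.1 this

/-- The probability of absorption at time `l + 3` exactly is increasing in the initial state. -/
lemma pow_absorb_sub_mono (hA : OrderedChain A) (l : ℕ) :
    Monotone fun i => (A ^ (l + 3)) i 0 - (A ^ (l + 2)) i 0 := by
  induction l with
  | zero =>
    have : (fun i => (A ^ (0 + 3)) i 0 - (A ^ (0 + 2)) i 0)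
        = fun i => ∑ j, A i j * exit2 A j := by
      funext i
      rw [pow_succ_apply A 2, pow_succ_apply A 1, ← Finset.sum_sub_distrib]
      exact Finset.sum_congr rfl fun j _ => by rw [exit2, pow_one, mul_sub]
    rw [this]
    exact hA.sum_mul_exit2_mono
  | succ l ih =>
    have h := hA.monotone_mulVec ih
    have e : (fun i => (A ^ (l + 1 + 3)) i 0 - (A ^ (l + 1 + 2)) i 0)
        = fun i => ∑ j, A i j * ((A ^ (l + 3)) j 0 - (A ^ (l + 2)) j 0) := by
      funext i
      simp only [mul_sub, Finset.sum_sub_distrib, ← pow_succ_apply]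
    rw [e]
    exact h

end OrderedChain
/-! ### The monotone likelihood ratio order on beliefs -/

lemma Belief.nonneg {k : ℕ} (π : Belief k) (i : Fin k) : 0 ≤ π i := π.2.1 i

lemma Belief.sum_eq_one {k : ℕ} (π : Belief k) : ∑ i, π i = 1 := π.2.2

/-- Beliefs in the monotone likelihood ratio order are stochastically ordered. -/
lemma MLRGe.sum_mul_le {k : ℕ} {π₁ π₂ : Belief k} (h : MLRGe π₁ π₂) {c : Fin k → ℝ}
    (hc : Antitone c) : ∑ i, c i * π₁ i ≤ ∑ i, c i * π₂ i := by
  have := sum_mul_sum_le_of_mlr hc (x := π₁) (η := π₂)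
    fun i j hij => by rw [mul_comm (π₁ j)]; exact h i j hij
  rw [π₁.sum_eq_one, π₂.sum_eq_one, mul_one, one_mul] at this
  simpa only [mul_comm] using this

/-- Decreasing functions of the belief, with respect to the monotone likelihood ratio order. -/
def MLRAntitone {k : ℕ} (φ : Belief k → ℝ≥0∞) : Prop :=
  ∀ π₁ π₂, MLRGe π₁ π₂ → φ π₁ ≤ φ π₂

/-- Concave functions of the belief. Convex combinations of beliefs are described by their
coordinates, as the simplex carries no algebraic structure. -/
def BeliefConcave {k : ℕ} (φ : Belief k → ℝ≥0∞) : Prop :=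
  ∀ (a b : ℝ) (π π₁ π₂ : Belief k), 0 ≤ a → 0 ≤ b → a + b = 1 →
    (∀ i, π i = a * π₁ i + b * π₂ i) →
    ENNReal.ofReal a * φ π₁ + ENNReal.ofReal b * φ π₂ ≤ φ π

namespace Model

variable {n L : ℕ} (M : Model n L)

/-! ### Prediction and Bayes' rule

The filter is the composition of the predictor `(A')^l π` and of Bayes' rule. Separating the two
permits to compare predictors over horizons that are no sampling intervals. -/

/-- The predictor `(A')^l π`. -/
noncomputable def predict (l : ℕ) (π : Belief (n + 2)) : Belief (n + 2) :=
  ⟨fun i => ∑ j, (M.A ^ l) j i * π j,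
    fun i => Finset.sum_nonneg fun j _ => mul_nonneg (M.pow_nonneg' l j i) (π.nonneg j), by
      rw [Finset.sum_comm]
      simp only [← Finset.sum_mul, M.pow_row_sum, one_mul]
      exact π.sum_eq_one⟩

lemma predict_apply (l : ℕ) (π : Belief (n + 2)) (i : Fin (n + 2)) :
    M.predict l π i = ∑ j, (M.A ^ l) j i * π j := rfl

lemma sum_mul_predict (l : ℕ) (π : Belief (n + 2)) (c : Fin (n + 2) → ℝ) :
    ∑ i, c i * M.predict l π i = ∑ j, (∑ i, (M.A ^ l) j i * c i) * π j := by
  simp only [predict_apply, Finset.mul_sum, Finset.sum_mul]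
  rw [Finset.sum_comm]
  exact Finset.sum_congr rfl fun j _ => Finset.sum_congr rfl fun i _ => by ring

lemma predict_succ (l : ℕ) (π : Belief (n + 2)) :
    M.predict (l + 1) π = M.predict 1 (M.predict l π) := by
  refine Subtype.ext (funext fun i => ?_)
  change M.predict (l + 1) π i = M.predict 1 (M.predict l π) i
  rw [predict_apply, predict_apply, sum_mul_predict]
  simp only [pow_succ (M.A) l, Matrix.mul_apply, pow_one]

/-- Density of the observation when `p` is the law of the hidden state. -/
noncomputable def obsDensity (p : Belief (n + 2)) (y : ℝ) : ℝ := ∑ i, M.B i y * p i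

lemma obsDensity_nonneg (p : Belief (n + 2)) (y : ℝ) : 0 ≤ M.obsDensity p y :=
  Finset.sum_nonneg fun i _ => mul_nonneg (M.B_nonneg i y) (p.nonneg i)

open scoped Classical in
/-- Bayes' rule for an observation `y`; `p` itself if `y` has density zero. -/
noncomputable def bayes (p : Belief (n + 2)) (y : ℝ) : Belief (n + 2) :=
  if h : 0 < M.obsDensity p y then
    ⟨fun i => M.B i y * p i / M.obsDensity p y,
      fun i => div_nonneg (mul_nonneg (M.B_nonneg i y) (p.nonneg i)) h.le, by
        rw [← Finset.sum_div]; exact div_self h.ne'⟩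
  else p

lemma bayes_apply {p : Belief (n + 2)} {y : ℝ} (h : 0 < M.obsDensity p y) (i : Fin (n + 2)) :
    M.bayes p y i = M.B i y * p i / M.obsDensity p y := by
  unfold bayes; rw [dif_pos h]; rfl

lemma obsDensity_mul_bayes (p : Belief (n + 2)) (y : ℝ) (i : Fin (n + 2)) :
    M.obsDensity p y * M.bayes p y i = M.B i y * p i := by
  rcases (M.obsDensity_nonneg p y).eq_or_lt with h | h
  · have := (Finset.sum_eq_zero_iff_of_nonneg fun i _ =>
      mul_nonneg (M.B_nonneg i y) (p.nonneg i)).1 h.symm i (Finset.mem_univ i)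
    rw [this, ← h, zero_mul]
  · rw [M.bayes_apply h, mul_div_cancel₀ _ h.ne']

lemma sigma_eq (π : Belief (n + 2)) (y : ℝ) (u : Fin L) :
    M.sigma π y u = M.obsDensity (M.predict (M.D u) π) y := rfl

lemma filter_eq {π : Belief (n + 2)} {y : ℝ} {u : Fin L} (h : 0 < M.sigma π y u) :
    M.filter π y u = M.bayes (M.predict (M.D u) π) y := by
  unfold filter bayes
  rw [dif_pos h, dif_pos (show 0 < M.obsDensity (M.predict (M.D u) π) y from h)]
  rfl

lemma measurable_coord (i : Fin (n + 2)) : Measurable fun p : Belief (n + 2) => p i :=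
  (measurable_pi_apply i).comp measurable_subtype_coe

lemma measurable_predict (l : ℕ) : Measurable (M.predict l) := by
  refine Measurable.subtype_mk (measurable_pi_lambda _ fun i => ?_)
  exact Finset.measurable_sum _ fun j _ => measurable_const.mul (measurable_coord j)

lemma measurable_obsDensity :
    Measurable fun q : Belief (n + 2) × ℝ => M.obsDensity q.1 q.2 :=
  Finset.measurable_sum _ fun i _ => ((M.B_measurable i).comp measurable_snd).mul
    ((measurable_coord i).comp measurable_fst)

lemma measurable_bayes : Measurable fun q : Belief (n + 2) × ℝ => M.bayes q.1 q.2 := by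
  classical
  have key : Measurable fun q : Belief (n + 2) × ℝ => (M.bayes q.1 q.2).1 := by
    refine measurable_pi_lambda _ fun i => ?_
    have h : (fun q : Belief (n + 2) × ℝ => (M.bayes q.1 q.2).1 i) = fun q =>
        if 0 < M.obsDensity q.1 q.2 then M.B i q.2 * q.1 i / M.obsDensity q.1 q.2
        else q.1 i := by
      funext q
      unfold bayes
      split_ifs <;> rfl
    rw [h]
    exact Measurable.ite (measurableSet_lt measurable_const M.measurable_obsDensity)
      ((((M.B_measurable i).comp measurable_snd).mul
        ((measurable_coord i).comp measurable_fst)).div M.measurable_obsDensity)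
      ((measurable_coord i).comp measurable_fst)
  exact key.subtype_mk

/-- Expectation of `φ` at the updated belief, when `p` is the law of the hidden state. -/
noncomputable def expect (φ : Belief (n + 2) → ℝ≥0∞) (p : Belief (n + 2)) : ℝ≥0∞ :=
  ∫⁻ y, φ (M.bayes p y) * ENNReal.ofReal (M.obsDensity p y) ∂M.ν

lemma lintegral_filter (φ : Belief (n + 2) → ℝ≥0∞) (π : Belief (n + 2)) (u : Fin L) :
    ∫⁻ y, φ (M.filter π y u) * ENNReal.ofReal (M.sigma π y u) ∂M.ν
      = M.expect φ (M.predict (M.D u) π) := by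
  refine lintegral_congr fun y => ?_
  rcases (M.obsDensity_nonneg (M.predict (M.D u) π) y).eq_or_lt with h | h
  · rw [M.sigma_eq, ← h, ENNReal.ofReal_zero, mul_zero, mul_zero]
  · rw [M.filter_eq h, M.sigma_eq]

lemma measurable_obsDensity_right (p : Belief (n + 2)) : Measurable (M.obsDensity p) :=
  M.measurable_obsDensity.comp measurable_prodMk_left

lemma measurable_bayes_right (p : Belief (n + 2)) : Measurable (M.bayes p) :=
  M.measurable_bayes.comp measurable_prodMk_left

lemma measurable_expect {φ : Belief (n + 2) → ℝ≥0∞} (hφ : Measurable φ) :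
    Measurable (M.expect φ) :=
  Measurable.lintegral_prod_right' (f := fun q : Belief (n + 2) × ℝ =>
    φ (M.bayes q.1 q.2) * ENNReal.ofReal (M.obsDensity q.1 q.2))
    ((hφ.comp M.measurable_bayes).mul M.measurable_obsDensity.ennreal_ofReal)

lemma expect_mono {φ ψ : Belief (n + 2) → ℝ≥0∞} (h : φ ≤ ψ) (p : Belief (n + 2)) :
    M.expect φ p ≤ M.expect ψ p :=
  lintegral_mono fun _ => mul_le_mul_left (h _) _

lemma expect_add {φ : Belief (n + 2) → ℝ≥0∞} (hφ : Measurable φ) (ψ : Belief (n + 2) → ℝ≥0∞)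
    (p : Belief (n + 2)) :
    M.expect (fun π => φ π + ψ π) p = M.expect φ p + M.expect ψ p := by
  simp only [expect, add_mul]
  exact lintegral_add_left ((hφ.comp (M.measurable_bayes_right p)).mul
    (M.measurable_obsDensity_right p).ennreal_ofReal) _

/-- The updated belief is a martingale: linear functions of it have the expectation `c · p`. -/
lemma expect_linear {c : Fin (n + 2) → ℝ} (hc : ∀ i, 0 ≤ c i) (p : Belief (n + 2)) :
    M.expect (fun π => ENNReal.ofReal (∑ i, c i * π i)) p = ENNReal.ofReal (∑ i, c i * p i) := by
  have h1 : ∀ y, ENNReal.ofReal (∑ i, c i * M.bayes p y i) * ENNReal.ofReal (M.obsDensity p y)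
      = ∑ i, ENNReal.ofReal (c i * p i) * ENNReal.ofReal (M.B i y) := by
    intro y
    rw [← ENNReal.ofReal_mul
      (Finset.sum_nonneg fun i _ => mul_nonneg (hc i) ((M.bayes p y).nonneg i)), Finset.sum_mul]
    have h2 : ∀ i, c i * M.bayes p y i * M.obsDensity p y = c i * p i * M.B i y := by
      intro i
      rw [mul_assoc, mul_comm (M.bayes p y i), M.obsDensity_mul_bayes]; ring
    simp only [h2]
    rw [ENNReal.ofReal_sum_of_nonneg fun i _ =>
      mul_nonneg (mul_nonneg (hc i) (p.nonneg i)) (M.B_nonneg i y)]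
    exact Finset.sum_congr rfl fun i _ => ENNReal.ofReal_mul (mul_nonneg (hc i) (p.nonneg i))
  unfold expect
  simp only [h1]
  rw [lintegral_finsetSum _ fun i _ => (M.B_measurable i).ennreal_ofReal.const_mul _]
  simp only [lintegral_const_mul _ (M.B_measurable _).ennreal_ofReal, M.B_lintegral, mul_one]
  rw [ENNReal.ofReal_sum_of_nonneg fun i _ => mul_nonneg (hc i) (p.nonneg i)]

lemma lintegral_obsDensity (p : Belief (n + 2)) :
    ∫⁻ y, ENNReal.ofReal (M.obsDensity p y) ∂M.ν = 1 := by
  have h := M.expect_linear (c := fun _ => 1) (fun _ => zero_le_one) p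
  simpa [expect, Belief.sum_eq_one] using h

/-! ### Monotonicity of the filter -/

lemma mlrGe_bayes (hB : TP2 M.B) {p q : Belief (n + 2)} (h : MLRGe p q) {y z : ℝ} (hyz : y ≤ z)
    (hp : 0 < M.obsDensity p z) (hq : 0 < M.obsDensity q y) :
    MLRGe (M.bayes p z) (M.bayes q y) := by
  intro i j hij
  rw [M.bayes_apply hp, M.bayes_apply hp, M.bayes_apply hq, M.bayes_apply hq, div_mul_div_comm,
    div_mul_div_comm, mul_comm (M.obsDensity q y)]
  refine div_le_div_of_nonneg_right ?_ (mul_pos hp hq).le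
  have h1 : M.B i z * M.B j y ≤ M.B i y * M.B j z := by
    rcases hyz.eq_or_lt with rfl | hlt
    · exact le_rfl
    · exact sub_nonneg.1 (hB i j y z hij hlt)
  calc M.B i z * p i * (M.B j y * q j) = M.B i z * M.B j y * (p i * q j) := by ring
    _ ≤ M.B i y * M.B j z * (q i * p j) := mul_le_mul h1 (h i j hij)
        (mul_nonneg (p.nonneg i) (q.nonneg j)) (mul_nonneg (M.B_nonneg i y) (M.B_nonneg j z))
    _ = M.B i y * q i * (M.B j z * p j) := by ring

/-- The larger law of the hidden state makes larger observations more likely. -/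
lemma obsDensity_mul_le (hB : TP2 M.B) {p q : Belief (n + 2)} (h : MLRGe p q) {y z : ℝ}
    (hyz : y < z) :
    M.obsDensity p y * M.obsDensity q z ≤ M.obsDensity q y * M.obsDensity p z :=
  sum_mul_sum_le_swap (fun i j hij => by
    linarith [hB i j y z hij hyz]) h

/-- A decreasing function of the updated belief has the smaller expectation under the larger law of
the hidden state. Twice the expectation is written as an integral over two independent
observations, the second one drawn under the other law, and the integrands are compared for each
unordered pair of observations. -/
lemma expect_le_of_mlrGe (hB : TP2 M.B) {φ : Belief (n + 2) → ℝ≥0∞} (hm : Measurable φ)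
    (hφ : MLRAntitone φ) {p q : Belief (n + 2)} (h : MLRGe p q) :
    M.expect φ p ≤ M.expect φ q := by
  set a : ℝ → ℝ≥0∞ := fun y => ENNReal.ofReal (M.obsDensity p y) with ha
  set b : ℝ → ℝ≥0∞ := fun y => ENNReal.ofReal (M.obsDensity q y) with hb
  set φ₁ : ℝ → ℝ≥0∞ := fun y => φ (M.bayes p y) with hφ₁
  set φ₂ : ℝ → ℝ≥0∞ := fun y => φ (M.bayes q y) with hφ₂
  have ham : Measurable a := (M.measurable_obsDensity_right p).ennreal_ofReal
  have hbm : Measurable b := (M.measurable_obsDensity_right q).ennreal_ofReal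
  have h1m : Measurable φ₁ := hm.comp (M.measurable_bayes_right p)
  have h2m : Measurable φ₂ := hm.comp (M.measurable_bayes_right q)
  have h1am : Measurable fun y => φ₁ y * a y := h1m.mul ham
  have h2bm : Measurable fun y => φ₂ y * b y := h2m.mul hbm
  have ha1 : ∫⁻ y, a y ∂M.ν = 1 := M.lintegral_obsDensity p
  have hb1 : ∫⁻ y, b y ∂M.ν = 1 := M.lintegral_obsDensity q
  have hlt : ∀ y z, y < z → φ₁ y * a y * b z + b y * (φ₁ z * a z)
      ≤ a y * (φ₂ z * b z) + φ₂ y * b y * a z := by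
    intro y z hyz
    by_cases ht : b y * a z = 0
    · have hs : a y * b z = 0 := by
        have : a y * b z ≤ b y * a z := by
          simp only [ha, hb, ← ENNReal.ofReal_mul (M.obsDensity_nonneg _ _)]
          exact ENNReal.ofReal_le_ofReal (M.obsDensity_mul_le hB h hyz)
        exact le_antisymm (this.trans ht.le) zero_le
      have e1 : φ₁ y * a y * b z + b y * (φ₁ z * a z) = φ₁ y * (a y * b z) + φ₁ z * (b y * a z) := by
        ring
      rw [e1, hs, ht, mul_zero, mul_zero, add_zero]
      exact zero_le
    have hby : 0 < M.obsDensity q y := by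
      by_contra hcon
      exact ht (by simp [hb, ENNReal.ofReal_of_nonpos (not_lt.1 hcon)])
    have haz : 0 < M.obsDensity p z := by
      by_contra hcon
      exact ht (by simp [ha, ENNReal.ofReal_of_nonpos (not_lt.1 hcon)])
    have hzy : φ₁ z ≤ φ₂ y := hφ _ _ (M.mlrGe_bayes hB h hyz.le haz hby)
    have hst : a y * b z ≤ b y * a z := by
      simp only [ha, hb, ← ENNReal.ofReal_mul (M.obsDensity_nonneg _ _)]
      exact ENNReal.ofReal_le_ofReal (M.obsDensity_mul_le hB h hyz)
    obtain ⟨r, hr⟩ := exists_add_of_le hst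
    have hs : (φ₁ y + φ₁ z) * (a y * b z) ≤ (φ₂ y + φ₂ z) * (a y * b z) := by
      by_cases hs0 : a y * b z = 0
      · rw [hs0, mul_zero, mul_zero]
      have hay : 0 < M.obsDensity p y := by
        by_contra hcon
        exact hs0 (by simp [ha, ENNReal.ofReal_of_nonpos (not_lt.1 hcon)])
      have hbz : 0 < M.obsDensity q z := by
        by_contra hcon
        exact hs0 (by simp [hb, ENNReal.ofReal_of_nonpos (not_lt.1 hcon)])
      exact mul_le_mul_left (add_le_add (hφ _ _ (M.mlrGe_bayes hB h le_rfl hay hby))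
        (hφ _ _ (M.mlrGe_bayes hB h le_rfl haz hbz))) _
    calc φ₁ y * a y * b z + b y * (φ₁ z * a z) = φ₁ y * (a y * b z) + φ₁ z * (b y * a z) := by ring
      _ = (φ₁ y + φ₁ z) * (a y * b z) + φ₁ z * r := by rw [hr]; ring
      _ ≤ (φ₂ y + φ₂ z) * (a y * b z) + φ₂ y * r := add_le_add hs (mul_le_mul_left hzy _)
      _ = φ₂ z * (a y * b z) + φ₂ y * (b y * a z) := by rw [hr]; ring
      _ = a y * (φ₂ z * b z) + φ₂ y * b y * a z := by ring
  have hle : ∀ y z, φ₁ y * a y * b z + b y * (φ₁ z * a z)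
      ≤ a y * (φ₂ z * b z) + φ₂ y * b y * a z := by
    intro y z
    rcases lt_trichotomy y z with hyz | rfl | hyz
    · exact hlt y z hyz
    · by_cases hay : 0 < M.obsDensity p y ∧ 0 < M.obsDensity q y
      · have := hφ _ _ (M.mlrGe_bayes hB h (le_refl y) hay.1 hay.2)
        calc φ₁ y * a y * b y + b y * (φ₁ y * a y) = φ₁ y * (2 * a y * b y) := by ring
          _ ≤ φ₂ y * (2 * a y * b y) := mul_le_mul_left this _
          _ = a y * (φ₂ y * b y) + φ₂ y * b y * a y := by ring
      · have : a y * b y = 0 := by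
          rcases not_and_or.1 hay with hcon | hcon
          · simp [ha, ENNReal.ofReal_of_nonpos (not_lt.1 hcon)]
          · simp [hb, ENNReal.ofReal_of_nonpos (not_lt.1 hcon)]
        have e1 : φ₁ y * a y * b y + b y * (φ₁ y * a y) = 2 * φ₁ y * (a y * b y) := by ring
        rw [e1, this, mul_zero]
        exact zero_le
    · calc φ₁ y * a y * b z + b y * (φ₁ z * a z) = φ₁ z * a z * b y + b z * (φ₁ y * a y) := by ring
        _ ≤ a z * (φ₂ y * b y) + φ₂ z * b z * a y := hlt z y hyz
        _ = a y * (φ₂ z * b z) + φ₂ y * b y * a z := by ring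
  have hint : ∫⁻ y, ∫⁻ z, (φ₁ y * a y * b z + b y * (φ₁ z * a z)) ∂M.ν ∂M.ν
      ≤ ∫⁻ y, ∫⁻ z, (a y * (φ₂ z * b z) + φ₂ y * b y * a z) ∂M.ν ∂M.ν :=
    lintegral_mono fun y => lintegral_mono fun z => hle y z
  have hL : ∫⁻ y, ∫⁻ z, (φ₁ y * a y * b z + b y * (φ₁ z * a z)) ∂M.ν ∂M.ν
      = 2 * M.expect φ p := by
    have : ∀ y, ∫⁻ z, (φ₁ y * a y * b z + b y * (φ₁ z * a z)) ∂M.ν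
        = φ₁ y * a y + b y * M.expect φ p := fun y => by
      rw [lintegral_add_left (hbm.const_mul _), lintegral_const_mul _ hbm, hb1, mul_one,
        lintegral_const_mul _ h1am]
      rfl
    simp only [this]
    rw [lintegral_add_left h1am, lintegral_mul_const _ hbm, hb1, one_mul, two_mul]
    rfl
  have hR : ∫⁻ y, ∫⁻ z, (a y * (φ₂ z * b z) + φ₂ y * b y * a z) ∂M.ν ∂M.ν
      = 2 * M.expect φ q := by
    have : ∀ y, ∫⁻ z, (a y * (φ₂ z * b z) + φ₂ y * b y * a z) ∂M.ν
        = a y * M.expect φ q + φ₂ y * b y := fun y => by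
      rw [lintegral_add_left (h2bm.const_mul _), lintegral_const_mul _ ham, ha1, mul_one,
        lintegral_const_mul _ h2bm]
      rfl
    simp only [this]
    rw [lintegral_add_left (ham.mul_const _), lintegral_mul_const _ ham, ha1, one_mul, two_mul]
    rfl
  rw [hL, hR] at hint
  exact (ENNReal.mul_le_mul_iff_right two_ne_zero ENNReal.ofNat_ne_top).1 hint

lemma mlrGe_predict_one (hA : TP2 M.A) {p q : Belief (n + 2)} (h : MLRGe p q) :
    MLRGe (M.predict 1 p) (M.predict 1 q) := by
  intro i j hij
  simp only [predict_apply, pow_one]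
  exact sum_mul_sum_le_swap (fun a b hab => by linarith [hA a b i j hab hij]) h

lemma mlrGe_predict (hA : TP2 M.A) {p q : Belief (n + 2)} (h : MLRGe p q) (l : ℕ) :
    MLRGe (M.predict l p) (M.predict l q) := by
  induction l with
  | zero =>
    intro i j hij
    simp only [predict_apply, pow_zero, Matrix.one_apply, ite_mul, one_mul, zero_mul,
      Finset.sum_ite_eq', Finset.mem_univ, if_true]
    exact h i j hij
  | succ l ih =>
    rw [M.predict_succ l, M.predict_succ l]
    exact M.mlrGe_predict_one hA ih

/-- Predictors decrease with the horizon, from horizon one on. -/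
lemma mlrGe_predict_succ (hA : TP2 M.A) (hA2 : MatrixOrder M.A (M.A ^ 2)) (π : Belief (n + 2))
    (l : ℕ) : MLRGe (M.predict (l + 1) π) (M.predict (l + 2) π) := by
  induction l with
  | zero =>
    intro i j hij
    simp only [predict_apply, zero_add, pow_one]
    rw [Finset.sum_mul_sum, Finset.sum_mul_sum]
    refine Finset.sum_le_sum fun a _ => Finset.sum_le_sum fun b _ => ?_
    calc M.A a i * π a * ((M.A ^ 2) b j * π b) = M.A a i * (M.A ^ 2) b j * (π a * π b) := by ring
      _ ≤ (M.A ^ 2) a i * M.A b j * (π a * π b) :=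
        mul_le_mul_of_nonneg_right (hA2 a b i j hij) (mul_nonneg (π.nonneg a) (π.nonneg b))
      _ = (M.A ^ 2) a i * π a * (M.A b j * π b) := by ring
  | succ l ih =>
    rw [M.predict_succ (l + 1), M.predict_succ (l + 2)]
    exact M.mlrGe_predict_one hA ih

/-- A decreasing function of the updated belief has an expectation that increases with the
horizon. The monotone likelihood ratio order is not transitive on beliefs with zeros, so the
horizons are compared one step at a time. -/
lemma expect_predict_le (hA : TP2 M.A) (hB : TP2 M.B) (hA2 : MatrixOrder M.A (M.A ^ 2))
    {φ : Belief (n + 2) → ℝ≥0∞} (hm : Measurable φ) (hφ : MLRAntitone φ) (π : Belief (n + 2))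
    {k l : ℕ} (hk : 0 < k) (hkl : k ≤ l) :
    M.expect φ (M.predict k π) ≤ M.expect φ (M.predict l π) := by
  induction l, hkl using Nat.le_induction with
  | base => exact le_rfl
  | succ l hkl ih =>
    obtain ⟨j, rfl⟩ := Nat.exists_eq_succ_of_ne_zero (hk.trans_le hkl).ne'
    exact ih.trans (M.expect_le_of_mlrGe hB hm hφ (M.mlrGe_predict_succ hA hA2 π j))

/-! ### Concavity of the filtered expectation -/

lemma beliefConcave_expect {φ : Belief (n + 2) → ℝ≥0∞} (hm : Measurable φ)
    (hφ : BeliefConcave φ) : BeliefConcave (M.expect φ) := by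
  intro a b p p₁ p₂ ha hb hab hp
  have hmeas : ∀ q : Belief (n + 2), Measurable fun y =>
      φ (M.bayes q y) * ENNReal.ofReal (M.obsDensity q y) := fun q =>
    (hm.comp (M.measurable_bayes_right q)).mul (M.measurable_obsDensity_right q).ennreal_ofReal
  unfold expect
  rw [← lintegral_const_mul _ (hmeas p₁), ← lintegral_const_mul _ (hmeas p₂),
    ← lintegral_add_left ((hmeas p₁).const_mul _)]
  refine lintegral_mono fun y => ?_
  set N := M.obsDensity p y with hN
  set n₁ := M.obsDensity p₁ y with hn₁
  set n₂ := M.obsDensity p₂ y with hn₂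
  have h₁ : 0 ≤ n₁ := M.obsDensity_nonneg p₁ y
  have h₂ : 0 ≤ n₂ := M.obsDensity_nonneg p₂ y
  have hsum : N = a * n₁ + b * n₂ := by
    simp only [hN, hn₁, hn₂, obsDensity, Finset.mul_sum, ← Finset.sum_add_distrib]
    exact Finset.sum_congr rfl fun i _ => by rw [hp i]; ring
  have han : 0 ≤ a * n₁ := mul_nonneg ha h₁
  have hbn : 0 ≤ b * n₂ := mul_nonneg hb h₂
  rcases (M.obsDensity_nonneg p y).eq_or_lt with h0 | hpos
  · have e1 : a * n₁ = 0 := by linarith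
    have e2 : b * n₂ = 0 := by linarith
    calc ENNReal.ofReal a * (φ (M.bayes p₁ y) * ENNReal.ofReal n₁)
          + ENNReal.ofReal b * (φ (M.bayes p₂ y) * ENNReal.ofReal n₂)
        = φ (M.bayes p₁ y) * ENNReal.ofReal (a * n₁)
          + φ (M.bayes p₂ y) * ENNReal.ofReal (b * n₂) := by
          rw [ENNReal.ofReal_mul ha, ENNReal.ofReal_mul hb]; ring
      _ ≤ _ := by rw [e1, e2]; simp
  · have hT : ∀ i, M.bayes p y i
        = a * n₁ / N * M.bayes p₁ y i + b * n₂ / N * M.bayes p₂ y i := by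
      intro i
      have e1 := M.obsDensity_mul_bayes p₁ y i
      have e2 := M.obsDensity_mul_bayes p₂ y i
      have hN0 : N ≠ 0 := hpos.ne'
      rw [M.bayes_apply hpos, hp i, ← hN]
      field_simp
      linear_combination -a * e1 - b * e2
    have h := hφ (a * n₁ / N) (b * n₂ / N) _ _ _ (div_nonneg han hpos.le)
      (div_nonneg hbn hpos.le) (by rw [← add_div, ← hsum, div_self hpos.ne']) hT
    calc ENNReal.ofReal a * (φ (M.bayes p₁ y) * ENNReal.ofReal n₁)
          + ENNReal.ofReal b * (φ (M.bayes p₂ y) * ENNReal.ofReal n₂)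
        = φ (M.bayes p₁ y) * ENNReal.ofReal (a * n₁ / N * N)
          + φ (M.bayes p₂ y) * ENNReal.ofReal (b * n₂ / N * N) := by
          rw [div_mul_cancel₀ _ hpos.ne', div_mul_cancel₀ _ hpos.ne', ENNReal.ofReal_mul ha,
            ENNReal.ofReal_mul hb]
          ring
      _ = (ENNReal.ofReal (a * n₁ / N) * φ (M.bayes p₁ y)
          + ENNReal.ofReal (b * n₂ / N) * φ (M.bayes p₂ y)) * ENNReal.ofReal N := by
          rw [ENNReal.ofReal_mul (div_nonneg han hpos.le),
            ENNReal.ofReal_mul (div_nonneg hbn hpos.le)]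
          ring
      _ ≤ φ (M.bayes p y) * ENNReal.ofReal N := mul_le_mul_left h _

lemma predict_convexComb {a b : ℝ} {π π₁ π₂ : Belief (n + 2)}
    (h : ∀ i, π i = a * π₁ i + b * π₂ i) (l : ℕ) (i : Fin (n + 2)) :
    M.predict l π i = a * M.predict l π₁ i + b * M.predict l π₂ i := by
  simp only [predict_apply, Finset.mul_sum, ← Finset.sum_add_distrib]
  exact Finset.sum_congr rfl fun j _ => by rw [h j]; ring

/-! ### Cost vectors -/

lemma orderedChain (hA : TP2 M.A) (hA2 : MatrixOrder M.A (M.A ^ 2)) : OrderedChain M.A :=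
  ⟨M.A_nonneg, M.A_row_sum, M.A_absorbing, M.A_transient, hA, hA2⟩

lemma cost_zero (π : Belief (n + 2)) :
    M.cost π 0 = ∑ i, (if i = 0 then 0 else M.f) * π i := by
  change M.f * ∑ i, (if i = 0 then 0 else π i) = _
  rw [Finset.mul_sum]
  exact Finset.sum_congr rfl fun i _ => by split_ifs <;> ring

lemma cost_succ (π : Belief (n + 2)) (v : Fin L) :
    M.cost π v.succ = ∑ i, M.continueCost v i * π i := rfl

lemma continueCost_nonneg (v : Fin L) (i : Fin (n + 2)) : 0 ≤ M.continueCost v i :=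
  add_nonneg (mul_nonneg M.d_nonneg (Finset.sum_nonneg fun l _ => M.pow_nonneg' l i 0))
    (M.m_nonneg i v)

/-- Cost vector of an arbitrary action. -/
noncomputable def costVec (u : Fin (L + 1)) (i : Fin (n + 2)) : ℝ :=
  Fin.cases (if i = 0 then 0 else M.f) (fun v => M.continueCost v i) u

lemma cost_eq (π : Belief (n + 2)) (u : Fin (L + 1)) :
    M.cost π u = ∑ i, M.costVec u i * π i := by
  refine Fin.cases ?_ (fun v => ?_) u
  · exact M.cost_zero π
  · exact M.cost_succ π v

lemma costVec_nonneg (u : Fin (L + 1)) (i : Fin (n + 2)) : 0 ≤ M.costVec u i := by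
  refine Fin.cases ?_ (fun v => ?_) u
  · change 0 ≤ (if i = 0 then 0 else M.f)
    split_ifs
    · exact le_rfl
    · exact M.f_nonneg
  · exact M.continueCost_nonneg v i

lemma cost_nonneg (π : Belief (n + 2)) (u : Fin (L + 1)) : 0 ≤ M.cost π u := by
  rw [cost_eq]
  exact Finset.sum_nonneg fun i _ => mul_nonneg (M.costVec_nonneg u i) (π.nonneg i)

lemma measurable_cost (u : Fin (L + 1)) : Measurable fun π : Belief (n + 2) => M.cost π u := by
  simp only [cost_eq]
  exact Finset.measurable_sum _ fun i _ => measurable_const.mul (measurable_coord i)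

lemma cost_convexComb {a b : ℝ} {π π₁ π₂ : Belief (n + 2)} (h : ∀ i, π i = a * π₁ i + b * π₂ i)
    (u : Fin (L + 1)) : M.cost π u = a * M.cost π₁ u + b * M.cost π₂ u := by
  simp only [cost_eq, Finset.mul_sum, ← Finset.sum_add_distrib]
  exact Finset.sum_congr rfl fun i _ => by rw [h i]; ring

/-- Cost vector of `C̄(π, u)` for a continue action `u`. -/
noncomputable def transformedVec (α : ℝ) (v : Fin L) (i : Fin (n + 2)) : ℝ :=
  M.continueCost v i + α * M.d * M.A i 0 - α * M.d * (M.A ^ (M.D v + 1)) i 0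

lemma transformedCost_succ (α : ℝ) (π : Belief (n + 2)) (v : Fin L) :
    M.transformedCost α π v.succ = ∑ i, M.transformedVec α v i * π i := by
  change M.cost π v.succ + α * M.d * ∑ i, M.A i 0 * π i
      - α * M.d * ∑ i, (M.A ^ (M.D v + 1)) i 0 * π i = _
  simp only [transformedVec, sub_mul, add_mul, Finset.sum_sub_distrib, Finset.sum_add_distrib,
    cost_succ, Finset.mul_sum, mul_assoc]

lemma pow_zero_row (l : ℕ) : (M.A ^ l) 0 0 = 1 := by
  induction l with
  | zero => simp
  | succ l ih =>
    rw [pow_succ', Matrix.mul_apply, Finset.sum_eq_single 0]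
    · rw [ih, M.A_absorbing, mul_one]
    · intro b _ hb
      rw [row_zero_eq_zero M.A_nonneg M.A_row_sum M.A_absorbing hb, zero_mul]
    · simp

lemma pow_le_one (l : ℕ) (i j : Fin (n + 2)) : (M.A ^ l) i j ≤ 1 := by
  rw [← M.pow_row_sum l i]
  exact Finset.single_le_sum (f := (M.A ^ l) i) (fun k _ => M.pow_nonneg' l i k)
    (Finset.mem_univ j)

lemma absorb_le_pow (l : ℕ) (i : Fin (n + 2)) : M.A i 0 ≤ (M.A ^ (l + 1)) i 0 := by
  rw [pow_succ, Matrix.mul_apply]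
  induction l with
  | zero => simp [Matrix.one_apply]
  | succ l ih =>
    refine ih.trans ?_
    rw [← Matrix.mul_apply, ← Matrix.mul_apply, ← pow_succ, ← pow_succ, pow_succ _ (l + 1),
      Matrix.mul_apply]
    have := Finset.single_le_sum (f := fun j => (M.A ^ (l + 1)) i j * M.A j 0)
      (fun j _ => mul_nonneg (M.pow_nonneg' _ i j) (M.A_nonneg j 0)) (Finset.mem_univ 0)
    simpa [M.A_absorbing] using this

/-- Under the monotonicity assumption on `α`, the transformed cost of a continue action is
decreasing in the state. -/
lemma transformedVec_antitone {α : ℝ} (hα : 0 < α) (hm : M.SamplingCostMonotone)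
    (hmono : M.AlphaMonotone α) (v : Fin L) : Antitone (M.transformedVec α v) := by
  have hrange : ∀ g : ℕ → ℝ, ∑ l ∈ Finset.range (M.D v), g l
      = g 0 + ∑ l ∈ Finset.Icc 1 (M.D v - 1), g l := by
    intro g
    have hD := M.D_pos v
    have : Finset.range (M.D v) = insert 0 (Finset.Icc 1 (M.D v - 1)) := by
      ext l; simp only [Finset.mem_range, Finset.mem_insert, Finset.mem_Icc]; omega
    rw [this, Finset.sum_insert (by simp)]
  intro i k hik
  have hmk := hm.1 v hik
  dsimp only at hmk
  by_cases hi : i = 0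
  · subst hi
    have h1 : M.continueCost v 0 = M.d * M.D v + M.m 0 v := by
      simp [continueCost, M.pow_zero_row]
    have h2 : M.continueCost v k ≤ M.d * M.D v + M.m k v := by
      have : ∑ l ∈ Finset.range (M.D v), (M.A ^ l) k 0 ≤ M.D v := by
        have := Finset.sum_le_card_nsmul (Finset.range (M.D v)) (fun l => (M.A ^ l) k 0) 1
          fun l _ => M.pow_le_one l k 0
        simpa using this
      exact add_le_add_left (mul_le_mul_of_nonneg_left this M.d_nonneg) _
    have h3 := M.absorb_le_pow (M.D v) k
    have h4 := mul_nonneg (mul_nonneg hα.le M.d_nonneg) (sub_nonneg.2 h3)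
    simp only [transformedVec, M.pow_zero_row, M.A_absorbing, h1]
    linarith
  · have h0 : ∀ j : Fin (n + 2), j ≠ 0 → M.continueCost v j
        = M.d * (∑ l ∈ Finset.Icc 1 (M.D v - 1), (M.A ^ l) j 0) + M.m j v := by
      intro j hj
      rw [continueCost, hrange, pow_zero, Matrix.one_apply, if_neg hj, zero_add]
    have hk : k ≠ 0 := fun hk => hi (le_antisymm (hk ▸ hik) (Fin.zero_le i))
    have h1 := mul_le_mul_of_nonneg_left (hmono v i k hi hik) M.d_nonneg
    simp only [transformedVec, h0 i hi, h0 k hk]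
    linarith

/-- The transformed costs have decreasing differences. The difference of the cost vectors of two
actions is, up to sampling costs, a sum of `(A^l)_{i1} - α ((A^(l+2))_{i1} - (A^(l+1))_{i1})`
over times `l ≥ 1`; absorption by time `l` is less likely, and absorption at time `l + 2` is more
likely, from a higher state. -/
lemma transformedVec_sub_antitone (hA : TP2 M.A) (hA2 : MatrixOrder M.A (M.A ^ 2)) {α : ℝ}
    (hα : 0 < α) (hm : M.SamplingCostMonotone) {u v : Fin L} (huv : u ≤ v) :
    Antitone fun i => M.transformedVec α v i - M.transformedVec α u i := by
  have hO := M.orderedChain hA hA2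
  have hD : M.D u ≤ M.D v := M.D_strictMono.monotone huv
  have key : ∀ i, M.transformedVec α v i - M.transformedVec α u i
      = M.d * (∑ l ∈ Finset.Ico (M.D u) (M.D v), ((M.A ^ l) i 0
        - α * ((M.A ^ (l + 2)) i 0 - (M.A ^ (l + 1)) i 0))) + (M.m i v - M.m i u) := by
    intro i
    have h1 : ∑ l ∈ Finset.range (M.D v), (M.A ^ l) i 0 - ∑ l ∈ Finset.range (M.D u), (M.A ^ l) i 0
        = ∑ l ∈ Finset.Ico (M.D u) (M.D v), (M.A ^ l) i 0 :=
      (Finset.sum_Ico_eq_sub _ hD).symm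
    have h2 : ∑ l ∈ Finset.Ico (M.D u) (M.D v), ((M.A ^ (l + 2)) i 0 - (M.A ^ (l + 1)) i 0)
        = (M.A ^ (M.D v + 1)) i 0 - (M.A ^ (M.D u + 1)) i 0 :=
      Finset.sum_Ico_sub (fun l => (M.A ^ (l + 1)) i 0) hD
    rw [Finset.sum_sub_distrib, ← Finset.mul_sum, h2, ← h1]
    simp only [transformedVec, continueCost]
    ring
  intro i k hik
  simp only [key]
  refine add_le_add (mul_le_mul_of_nonneg_left (Finset.sum_le_sum fun l hl => ?_) M.d_nonneg)
    (hm.2 u v huv hik)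
  have hl1 : 0 < l := (M.D_pos u).trans_le (Finset.mem_Ico.1 hl).1
  obtain ⟨j, rfl⟩ := Nat.exists_eq_succ_of_ne_zero hl1.ne'
  have h1 := hO.pow_absorb_antitone (j + 1) hik
  have h2 := mul_le_mul_of_nonneg_left (hO.pow_absorb_sub_mono j hik) hα.le
  simp only [Nat.succ_eq_add_one, add_assoc] at h1 h2 ⊢
  norm_num at h1 h2 ⊢
  linarith

/-! ### Value iteration -/

/-- `Q(π, u)` with the function `φ` in place of the optimal value. -/
noncomputable def actionValue (φ : Belief (n + 2) → ℝ≥0∞) (u : Fin (L + 1))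
    (π : Belief (n + 2)) : ℝ≥0∞ :=
  ENNReal.ofReal (M.cost π u) +
    Fin.cases 0 (fun v => M.expect φ (M.predict (M.D v) π)) u

lemma actionValue_zero (φ : Belief (n + 2) → ℝ≥0∞) (π : Belief (n + 2)) :
    M.actionValue φ 0 π = ENNReal.ofReal (M.cost π 0) := add_zero _

lemma actionValue_succ (φ : Belief (n + 2) → ℝ≥0∞) (v : Fin L) (π : Belief (n + 2)) :
    M.actionValue φ v.succ π
      = ENNReal.ofReal (M.cost π v.succ) + M.expect φ (M.predict (M.D v) π) := rfl

/-- The dynamic programming operator. -/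
noncomputable def bellman (φ : Belief (n + 2) → ℝ≥0∞) (π : Belief (n + 2)) : ℝ≥0∞ :=
  ⨅ u, M.actionValue φ u π

/-- Value iteration from the zero function. -/
noncomputable def valueIter : ℕ → Belief (n + 2) → ℝ≥0∞
  | 0 => 0
  | k + 1 => M.bellman (valueIter k)

lemma measurable_actionValue {φ : Belief (n + 2) → ℝ≥0∞} (hφ : Measurable φ)
    (u : Fin (L + 1)) : Measurable (M.actionValue φ u) := by
  refine (M.measurable_cost u).ennreal_ofReal.add ?_
  refine Fin.cases ?_ (fun v => ?_) u
  · exact measurable_const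
  · exact (M.measurable_expect hφ).comp (M.measurable_predict _)

lemma measurable_valueIter (k : ℕ) : Measurable (M.valueIter k) := by
  induction k with
  | zero => exact measurable_const
  | succ k ih => exact Measurable.iInf fun u => M.measurable_actionValue ih u

lemma actionValue_mono {φ ψ : Belief (n + 2) → ℝ≥0∞} (h : φ ≤ ψ) (u : Fin (L + 1))
    (π : Belief (n + 2)) : M.actionValue φ u π ≤ M.actionValue ψ u π := by
  refine add_le_add le_rfl ?_
  refine Fin.cases ?_ (fun v => ?_) u
  · exact le_rfl
  · exact M.expect_mono h _

lemma bellman_mono {φ ψ : Belief (n + 2) → ℝ≥0∞} (h : φ ≤ ψ) : M.bellman φ ≤ M.bellman ψ :=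
  fun π => iInf_mono fun u => M.actionValue_mono h u π

lemma valueIter_mono : Monotone M.valueIter := by
  refine monotone_nat_of_le_succ fun k => ?_
  induction k with
  | zero => exact fun _ => zero_le
  | succ k ih => exact M.bellman_mono ih

/-- The limit of value iteration. -/
noncomputable def valueLim (π : Belief (n + 2)) : ℝ≥0∞ := ⨆ k, M.valueIter k π

lemma measurable_valueLim : Measurable M.valueLim :=
  Measurable.iSup fun k => M.measurable_valueIter k

lemma expect_valueLim (p : Belief (n + 2)) :
    M.expect M.valueLim p = ⨆ k, M.expect (M.valueIter k) p := by
  simp only [expect, valueLim, ENNReal.iSup_mul]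
  refine lintegral_iSup (fun k => ?_) fun i j hij y => mul_le_mul_left (M.valueIter_mono hij _) _
  exact ((M.measurable_valueIter k).comp (M.measurable_bayes_right p)).mul
    (M.measurable_obsDensity_right p).ennreal_ofReal

lemma actionValue_valueLim (u : Fin (L + 1)) (π : Belief (n + 2)) :
    M.actionValue M.valueLim u π = ⨆ k, M.actionValue (M.valueIter k) u π := by
  refine Fin.cases ?_ (fun v => ?_) u
  · simp only [actionValue_zero, ciSup_const]
  · simp only [actionValue_succ, expect_valueLim, ENNReal.add_iSup]

/-- The limit of value iteration solves the dynamic programming equation. -/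
lemma bellman_valueLim : M.bellman M.valueLim = M.valueLim := by
  funext π
  have h1 : M.bellman M.valueLim π = ⨆ k, M.valueIter (k + 1) π := by
    simp only [bellman, actionValue_valueLim, valueIter]
    exact (iSup_iInf_of_monotone
      fun u i j hij => M.actionValue_mono (M.valueIter_mono hij) u π).symm
  rw [h1]
  exact Monotone.iSup_nat_add (f := fun k => M.valueIter k π)
    (fun i j hij => M.valueIter_mono hij π) 1

lemma valueLim_le (π : Belief (n + 2)) : M.valueLim π ≤ ENNReal.ofReal (M.cost π 0) := by
  rw [← M.bellman_valueLim, ← M.actionValue_zero M.valueLim π]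
  exact iInf_le _ 0

lemma actionValue_valueLim_ne_top (u : Fin (L + 1)) (π : Belief (n + 2)) :
    M.actionValue M.valueLim u π ≠ ∞ := by
  refine ENNReal.add_ne_top.2 ⟨ENNReal.ofReal_ne_top, ?_⟩
  refine Fin.cases ENNReal.zero_ne_top (fun v => ?_) u
  refine ne_top_of_le_ne_top (b := M.expect (fun π => ENNReal.ofReal (∑ i, M.costVec 0 i * π i))
    (M.predict (M.D v) π)) ?_ (M.expect_mono (fun π => ?_) _)
  · rw [M.expect_linear (M.costVec_nonneg 0)]
    exact ENNReal.ofReal_ne_top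
  · rw [← M.cost_eq]
    exact M.valueLim_le π

/-! ### Concavity of the value -/

lemma beliefConcave_actionValue {φ : Belief (n + 2) → ℝ≥0∞} (hm : Measurable φ)
    (hφ : BeliefConcave φ) (u : Fin (L + 1)) : BeliefConcave (M.actionValue φ u) := by
  intro a b π π₁ π₂ ha hb hab hπ
  have hc : ENNReal.ofReal a * ENNReal.ofReal (M.cost π₁ u)
      + ENNReal.ofReal b * ENNReal.ofReal (M.cost π₂ u) = ENNReal.ofReal (M.cost π u) := by
    rw [M.cost_convexComb hπ, ENNReal.ofReal_add (mul_nonneg ha (M.cost_nonneg _ _))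
      (mul_nonneg hb (M.cost_nonneg _ _)), ENNReal.ofReal_mul ha, ENNReal.ofReal_mul hb]
  simp only [actionValue, mul_add]
  rw [add_add_add_comm, hc]
  refine add_le_add le_rfl ?_
  refine Fin.cases ?_ (fun v => ?_) u
  · simp
  · exact M.beliefConcave_expect hm hφ a b _ _ _ ha hb hab
      (M.predict_convexComb hπ (M.D v))

lemma beliefConcave_valueIter (k : ℕ) : BeliefConcave (M.valueIter k) := by
  induction k with
  | zero => intro a b π π₁ π₂ _ _ _ _; simp [valueIter]
  | succ k ih =>
    intro a b π π₁ π₂ ha hb hab hπ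
    refine le_iInf fun u => ?_
    refine le_trans ?_
      (M.beliefConcave_actionValue (M.measurable_valueIter k) ih u a b π π₁ π₂ ha hb hab hπ)
    exact add_le_add (mul_le_mul_right (iInf_le _ u) _) (mul_le_mul_right (iInf_le _ u) _)

lemma beliefConcave_valueLim : BeliefConcave M.valueLim := by
  intro a b π π₁ π₂ ha hb hab hπ
  simp only [valueLim, ENNReal.mul_iSup]
  rw [ENNReal.iSup_add_iSup_of_monotone]
  · exact iSup_mono fun k => M.beliefConcave_valueIter k a b π π₁ π₂ ha hb hab hπ
  · exact fun i j hij => mul_le_mul_right (M.valueIter_mono hij _) _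
  · exact fun i j hij => mul_le_mul_right (M.valueIter_mono hij _) _

/-! ### Monotonicity of the shifted value -/

/-- The shift `α d e₁' A' π`. The value itself need not be decreasing, but its sum with the shift
is; the shift turns the cost `C` into `C̄` in the dynamic programming equation. -/
noncomputable def shift (α : ℝ) (π : Belief (n + 2)) : ℝ :=
  ∑ i, α * M.d * M.A i 0 * π i

lemma shiftVec_nonneg {α : ℝ} (hα : 0 < α) (i : Fin (n + 2)) : 0 ≤ α * M.d * M.A i 0 :=
  mul_nonneg (mul_nonneg hα.le M.d_nonneg) (M.A_nonneg i 0)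

lemma shift_nonneg {α : ℝ} (hα : 0 < α) (π : Belief (n + 2)) : 0 ≤ M.shift α π :=
  Finset.sum_nonneg fun i _ => mul_nonneg (M.shiftVec_nonneg hα i) (π.nonneg i)

lemma measurable_shift (α : ℝ) : Measurable (M.shift α) :=
  Finset.measurable_sum _ fun i _ => measurable_const.mul (measurable_coord i)

lemma expect_shift {α : ℝ} (hα : 0 < α) (p : Belief (n + 2)) :
    M.expect (fun π => ENNReal.ofReal (M.shift α π)) p = ENNReal.ofReal (M.shift α p) :=
  M.expect_linear (M.shiftVec_nonneg hα) p

lemma transformedCost_zero (α : ℝ) (π : Belief (n + 2)) :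
    M.transformedCost α π 0 = M.cost π 0 + M.shift α π := by
  simp only [shift, mul_assoc, ← Finset.mul_sum]
  change M.cost π 0 + α * M.d * ∑ i, M.A i 0 * π i = _
  ring

/-- `C̄(π, u)` is the cost increased by the shift now and decreased by the mean shift later. -/
lemma transformedCost_eq (α : ℝ) (π : Belief (n + 2)) (v : Fin L) :
    M.transformedCost α π v.succ
      = M.cost π v.succ + M.shift α π - M.shift α (M.predict (M.D v) π) := by
  have h : M.shift α (M.predict (M.D v) π)
      = α * M.d * ∑ i, (M.A ^ (M.D v + 1)) i 0 * π i := by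
    rw [shift, M.sum_mul_predict, Finset.mul_sum]
    refine Finset.sum_congr rfl fun j _ => ?_
    rw [pow_succ, Matrix.mul_apply, Finset.sum_mul, Finset.sum_mul, Finset.mul_sum]
    exact Finset.sum_congr rfl fun i _ => by ring
  rw [h]
  simp only [shift, mul_assoc, ← Finset.mul_sum]
  change M.cost π v.succ + α * M.d * ∑ i, M.A i 0 * π i
      - α * M.d * ∑ i, (M.A ^ (M.D v + 1)) i 0 * π i = _
  ring

/-- If `C̄(π₁, v₁) + δ ≤ C̄(π₂, v₂)` and the shifted continuation values are ordered alike, the shifted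
action values differ by at least `δ`. The transformed costs can be negative, hence the detour through sums. -/
lemma actionValue_add_shift_le {α : ℝ} (hα : 0 < α) {φ : Belief (n + 2) → ℝ≥0∞}
    (hm : Measurable φ) {π₁ π₂ : Belief (n + 2)} {v₁ v₂ : Fin L} {δ : ℝ} (hδ : 0 ≤ δ)
    (hC : M.transformedCost α π₁ v₁.succ + δ ≤ M.transformedCost α π₂ v₂.succ)
    (hE : M.expect (fun π => φ π + ENNReal.ofReal (M.shift α π)) (M.predict (M.D v₁) π₁)
      ≤ M.expect (fun π => φ π + ENNReal.ofReal (M.shift α π)) (M.predict (M.D v₂) π₂)) :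
    M.actionValue φ v₁.succ π₁ + ENNReal.ofReal (M.shift α π₁) + ENNReal.ofReal δ
      ≤ M.actionValue φ v₂.succ π₂ + ENNReal.ofReal (M.shift α π₂) := by
  rw [M.expect_add hm, M.expect_add hm, M.expect_shift hα, M.expect_shift hα] at hE
  rw [transformedCost_eq, transformedCost_eq] at hC
  set s₁ := M.shift α (M.predict (M.D v₁) π₁) with hs₁
  set s₂ := M.shift α (M.predict (M.D v₂) π₂) with hs₂
  have h1 : 0 ≤ s₁ := M.shift_nonneg hα _
  have h2 : 0 ≤ s₂ := M.shift_nonneg hα _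
  have hX : ENNReal.ofReal (M.cost π₁ v₁.succ) + ENNReal.ofReal (M.shift α π₁) + ENNReal.ofReal s₂
        + ENNReal.ofReal δ
      ≤ ENNReal.ofReal (M.cost π₂ v₂.succ) + ENNReal.ofReal (M.shift α π₂)
        + ENNReal.ofReal s₁ := by
    have c1 := M.cost_nonneg π₁ v₁.succ
    have c2 := M.cost_nonneg π₂ v₂.succ
    have c3 := M.shift_nonneg hα π₁
    have c4 := M.shift_nonneg hα π₂
    rw [← ENNReal.ofReal_add c1 c3, ← ENNReal.ofReal_add (add_nonneg c1 c3) h2,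
      ← ENNReal.ofReal_add (add_nonneg (add_nonneg c1 c3) h2) hδ,
      ← ENNReal.ofReal_add c2 c4, ← ENNReal.ofReal_add (add_nonneg c2 c4) h1]
    exact ENNReal.ofReal_le_ofReal (by linarith)
  rw [actionValue_succ, actionValue_succ]
  have hfin : ENNReal.ofReal s₁ + ENNReal.ofReal s₂ ≠ ∞ :=
    ENNReal.add_ne_top.2 ⟨ENNReal.ofReal_ne_top, ENNReal.ofReal_ne_top⟩
  refine (ENNReal.add_le_add_iff_right hfin).1 ?_
  refine le_of_eq_of_le ?_ ((add_le_add hX hE).trans_eq ?_) <;> ring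

lemma mlrAntitone_ofReal {c : Fin (n + 2) → ℝ} (hc : Antitone c) :
    MLRAntitone fun π : Belief (n + 2) => ENNReal.ofReal (∑ i, c i * π i) :=
  fun _ _ h => ENNReal.ofReal_le_ofReal (h.sum_mul_le hc)

lemma shift_antitone (hA : TP2 M.A) {α : ℝ} (hα : 0 < α) :
    MLRAntitone fun π => ENNReal.ofReal (M.shift α π) :=
  mlrAntitone_ofReal fun _ _ hij =>
    mul_le_mul_of_nonneg_left (hA.antitone_col_zero M.A_row_sum hij) (mul_nonneg hα.le M.d_nonneg)

lemma stop_antitone (hA : TP2 M.A) {α : ℝ} (hα : M.AlphaLarge α) :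
    MLRAntitone fun π => ENNReal.ofReal (M.transformedCost α π 0) := by
  have e : ∀ π : Belief (n + 2), M.transformedCost α π 0
      = ∑ i, ((if i = 0 then 0 else M.f) + α * M.d * M.A i 0) * π i := by
    intro π
    rw [transformedCost_zero, cost_zero, shift, ← Finset.sum_add_distrib]
    exact Finset.sum_congr rfl fun i _ => by ring
  simp only [e]
  refine mlrAntitone_ofReal fun i k hik => ?_
  have hd := mul_nonneg hα.1.le M.d_nonneg
  have hA0 := hA.antitone_col_zero M.A_row_sum
  by_cases hk : k = 0
  · have hi : i = 0 := le_antisymm (hk ▸ hik) (Fin.zero_le i)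
    rw [hi, hk]
  · by_cases hi : i = 0
    · have h1 : (1 : Fin (n + 2)) ≤ k := by
        rw [Fin.le_def, Fin.val_one]
        exact Nat.one_le_iff_ne_zero.2 fun h => hk (Fin.ext h)
      have h2 := mul_le_mul_of_nonneg_left (hA0 h1) hd
      have h3 := hα.2
      rw [if_neg hk, if_pos hi, hi, M.A_absorbing]
      linarith
    · rw [if_neg hk, if_neg hi]
      exact add_le_add le_rfl (mul_le_mul_of_nonneg_left (hA0 hik) hd)

lemma transformedCost_le (hm : M.SamplingCostMonotone) {α : ℝ} (hα : 0 < α)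
    (hmono : M.AlphaMonotone α) {π₁ π₂ : Belief (n + 2)} (h : MLRGe π₁ π₂) (v : Fin L) :
    M.transformedCost α π₁ v.succ ≤ M.transformedCost α π₂ v.succ := by
  rw [transformedCost_succ, transformedCost_succ]
  exact h.sum_mul_le (M.transformedVec_antitone hα hm hmono v)

lemma mlrAntitone_valueIter (hA : TP2 M.A) (hB : TP2 M.B) (hm : M.SamplingCostMonotone) {α : ℝ}
    (hα : M.AlphaLarge α) (hmono : M.AlphaMonotone α) (k : ℕ) :
    MLRAntitone fun π => M.valueIter k π + ENNReal.ofReal (M.shift α π) := by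
  induction k with
  | zero => simpa [valueIter] using M.shift_antitone hA hα.1
  | succ k ih =>
    intro π₁ π₂ h
    have hmeas := M.measurable_valueIter k
    simp only [valueIter, bellman, ENNReal.iInf_add]
    refine le_iInf fun u => iInf_le_of_le u ?_
    refine Fin.cases ?_ (fun v => ?_) u
    · have := M.stop_antitone hA hα π₁ π₂ h
      simp only [transformedCost_zero] at this
      rw [ENNReal.ofReal_add (M.cost_nonneg _ _) (M.shift_nonneg hα.1 _),
        ENNReal.ofReal_add (M.cost_nonneg _ _) (M.shift_nonneg hα.1 _)] at this
      rwa [actionValue_zero, actionValue_zero]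
    · have hC := M.transformedCost_le hm hα.1 hmono h v
      rw [← add_zero (M.transformedCost α π₁ v.succ)] at hC
      have := M.actionValue_add_shift_le hα.1 hmeas le_rfl hC
        (M.expect_le_of_mlrGe hB (hmeas.add (M.measurable_shift α).ennreal_ofReal) ih
          (M.mlrGe_predict hA h _))
      rwa [ENNReal.ofReal_zero, add_zero] at this

lemma mlrAntitone_valueLim (hA : TP2 M.A) (hB : TP2 M.B) (hm : M.SamplingCostMonotone) {α : ℝ}
    (hα : M.AlphaLarge α) (hmono : M.AlphaMonotone α) :
    MLRAntitone fun π => M.valueLim π + ENNReal.ofReal (M.shift α π) := by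
  intro π₁ π₂ h
  simp only [valueLim, ENNReal.iSup_add]
  exact iSup_mono fun k => M.mlrAntitone_valueIter hA hB hm hα hmono k π₁ π₂ h

/-! ### Comparison of actions -/

/-- A longer sampling interval that is worse by `δ` for the transformed cost is worse by `δ` for
the original problem. -/
lemma actionValue_add_le (hA : TP2 M.A) (hB : TP2 M.B)
    (hA2 : MatrixOrder M.A (M.A ^ 2)) (hm : M.SamplingCostMonotone) {α : ℝ}
    (hα : M.AlphaLarge α) (hmono : M.AlphaMonotone α) {π : Belief (n + 2)} {u v : Fin L}
    (huv : u ≤ v) {δ : ℝ} (hδ : 0 ≤ δ)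
    (hC : M.transformedCost α π u.succ + δ ≤ M.transformedCost α π v.succ) :
    M.actionValue M.valueLim u.succ π + ENNReal.ofReal δ ≤ M.actionValue M.valueLim v.succ π := by
  have hmeas := M.measurable_valueLim
  refine (ENNReal.add_le_add_iff_right (ENNReal.ofReal_ne_top (r := M.shift α π))).1 ?_
  rw [add_right_comm]
  refine M.actionValue_add_shift_le hα.1 hmeas hδ hC ?_
  exact M.expect_predict_le hA hB hA2 (hmeas.add (M.measurable_shift α).ennreal_ofReal)
    (M.mlrAntitone_valueLim hA hB hm hα hmono) π (M.D_pos u) (M.D_strictMono.monotone huv)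

lemma transformedCost_sub_le (hA : TP2 M.A) (hA2 : MatrixOrder M.A (M.A ^ 2)) {α : ℝ}
    (hα : 0 < α) (hm : M.SamplingCostMonotone) {u v : Fin L} (huv : u ≤ v)
    {π₁ π₂ : Belief (n + 2)} (h : MLRGe π₁ π₂) :
    M.transformedCost α π₁ v.succ - M.transformedCost α π₁ u.succ
      ≤ M.transformedCost α π₂ v.succ - M.transformedCost α π₂ u.succ := by
  simp only [transformedCost_succ, ← Finset.sum_sub_distrib, ← sub_mul]
  exact h.sum_mul_le (M.transformedVec_sub_antitone hA hA2 hα hm huv)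

/-! ### One step of the controlled process -/

/-- Mean of a function of hidden state and belief, when the belief is the law of the hidden
state. -/
noncomputable def avg (G : State n → ℝ≥0∞) (π : Belief (n + 2)) : ℝ≥0∞ :=
  ∑ x, ENNReal.ofReal (π x) * G (x, π)

lemma avg_snd (g : Belief (n + 2) → ℝ≥0∞) (π : Belief (n + 2)) :
    avg (fun z : State n => g z.2) π = g π := by
  simp only [avg]
  rw [← Finset.sum_mul, ← ENNReal.ofReal_sum_of_nonneg fun i _ => π.nonneg i, π.sum_eq_one,
    ENNReal.ofReal_one, one_mul]

lemma lintegral_hiddenObsKernel (u : Fin L) (x : Fin (n + 2)) {F : Fin (n + 2) × ℝ → ℝ≥0∞}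
    (hF : Measurable F) :
    ∫⁻ p, F p ∂(M.hiddenObsKernel u x)
      = ∑ x', ENNReal.ofReal ((M.A ^ M.D u) x x') *
        ∫⁻ y, F (x', y) * ENNReal.ofReal (M.B x' y) ∂M.ν := by
  rw [hiddenObsKernel, Kernel.lintegral_compProd _ _ _ hF]
  change ∫⁻ b, _ ∂(∑ x', ENNReal.ofReal ((M.A ^ M.D u) x x') • Measure.dirac x') = _
  rw [lintegral_finsetSum_measure]
  refine Finset.sum_congr rfl fun x' _ => ?_
  rw [lintegral_smul_measure, lintegral_dirac, smul_eq_mul]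
  congr 1
  change ∫⁻ y, F (x', y) ∂(M.ν.withDensity fun y => ENNReal.ofReal (M.B x' y)) = _
  have hm : Measurable fun y => F (x', y) := hF.comp measurable_prodMk_left
  rw [lintegral_withDensity_eq_lintegral_mul _ (M.B_measurable x').ennreal_ofReal hm]
  exact lintegral_congr fun y => mul_comm _ _

lemma lintegral_continueKernel (u : Fin L) (z : State n) {G : State n → ℝ≥0∞}
    (hG : Measurable G) :
    ∫⁻ w, G w ∂(M.continueKernel u z)
      = ∑ x', ENNReal.ofReal ((M.A ^ M.D u) z.1 x') *
        ∫⁻ y, G (x', M.filter z.2 y u) * ENNReal.ofReal (M.B x' y) ∂M.ν := by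
  have hmap : Measurable fun p : State n × (Fin (n + 2) × ℝ) =>
      ((p.2.1, M.filter p.1.2 p.2.2 u) : State n) :=
    (measurable_fst.comp measurable_snd).prodMk ((M.measurable_filter u).comp
      ((measurable_snd.comp measurable_fst).prodMk (measurable_snd.comp measurable_snd)))
  have hGm : Measurable fun p : State n × (Fin (n + 2) × ℝ) =>
      G (p.2.1, M.filter p.1.2 p.2.2 u) := hG.comp hmap
  rw [continueKernel, Kernel.lintegral_map _ hmap _ hG, Kernel.lintegral_id_prod hGm,
    Kernel.comap_apply]
  exact M.lintegral_hiddenObsKernel u z.1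
    (F := fun p => G (p.1, M.filter z.2 p.2 u))
    (hG.comp (measurable_fst.prodMk ((M.measurable_filter u).comp
      (measurable_const.prodMk measurable_snd))))

/-- Averaged over the hidden state, one step of the controlled process is the update of the
belief. -/
lemma avg_lintegral_continueKernel (u : Fin L) {G : State n → ℝ≥0∞} (hG : Measurable G)
    (π : Belief (n + 2)) :
    avg (fun z => ∫⁻ w, G w ∂(M.continueKernel u z)) π
      = M.expect (avg G) (M.predict (M.D u) π) := by
  set p := M.predict (M.D u) π with hp
  have hmG : ∀ x' : Fin (n + 2), Measurable fun y =>
      G (x', M.filter π y u) * ENNReal.ofReal (M.B x' y) := fun x' =>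
    (hG.comp (measurable_const.prodMk ((M.measurable_filter u).comp
      measurable_prodMk_left))).mul (M.B_measurable x').ennreal_ofReal
  have h1 : avg (fun z => ∫⁻ w, G w ∂(M.continueKernel u z)) π
      = ∑ x', ENNReal.ofReal (p x') *
        ∫⁻ y, G (x', M.filter π y u) * ENNReal.ofReal (M.B x' y) ∂M.ν := by
    simp only [avg, M.lintegral_continueKernel u _ hG, Finset.mul_sum]
    rw [Finset.sum_comm]
    refine Finset.sum_congr rfl fun x' _ => ?_
    rw [hp, predict_apply, ENNReal.ofReal_sum_of_nonneg fun j _ =>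
      mul_nonneg (M.pow_nonneg' _ j x') (π.nonneg j), Finset.sum_mul]
    refine Finset.sum_congr rfl fun x _ => ?_
    rw [ENNReal.ofReal_mul (M.pow_nonneg' _ x x')]
    ring
  rw [h1, ← M.lintegral_filter]
  simp only [← lintegral_const_mul _ (hmG _)]
  rw [← lintegral_finsetSum _ fun x' _ => (hmG x').const_mul _]
  refine lintegral_congr fun y => ?_
  simp only [avg, Finset.sum_mul]
  refine Finset.sum_congr rfl fun x' _ => ?_
  have h2 : M.filter π y u x' * M.sigma π y u = M.B x' y * p x' := by
    rcases (M.obsDensity_nonneg p y).eq_or_lt with h | h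
    · rw [M.sigma_eq, ← hp, ← M.obsDensity_mul_bayes p y x', ← h, mul_zero, zero_mul]
    · rw [M.filter_eq h, M.sigma_eq, mul_comm, ← hp, M.obsDensity_mul_bayes]
  calc ENNReal.ofReal (p x') * (G (x', M.filter π y u) * ENNReal.ofReal (M.B x' y))
      = ENNReal.ofReal (M.B x' y * p x') * G (x', M.filter π y u) := by
        rw [ENNReal.ofReal_mul (M.B_nonneg x' y)]; ring
    _ = ENNReal.ofReal (M.filter π y u x' * M.sigma π y u) * G (x', M.filter π y u) := by rw [h2]
    _ = _ := by
        rw [ENNReal.ofReal_mul ((M.filter π y u).nonneg x')]; ring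

/-- The sub-Markov operator on functions of the belief of one epoch under a strategy; the process
is killed when the strategy stops. -/
noncomputable def stepOp (μ : Strategy n L) (g : Belief (n + 2) → ℝ≥0∞) (π : Belief (n + 2)) :
    ℝ≥0∞ :=
  Fin.cases 0 (fun v => M.expect g (M.predict (M.D v) π)) (μ.1 π)

lemma actionValue_eq_stepOp (μ : Strategy n L) (g : Belief (n + 2) → ℝ≥0∞)
    (π : Belief (n + 2)) :
    M.actionValue g (μ.1 π) π = ENNReal.ofReal (M.cost π (μ.1 π)) + M.stepOp μ g π := rfl

lemma measurable_strategy_apply (μ : Strategy n L) {g : Fin (L + 1) → Belief (n + 2) → ℝ≥0∞}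
    (hg : ∀ u, Measurable (g u)) : Measurable fun π => g (μ.1 π) π := by
  have h : Measurable (Function.uncurry g) := measurable_from_prod_countable_right hg
  exact h.comp (μ.2.prodMk measurable_id)

lemma measurable_stepOp (μ : Strategy n L) {g : Belief (n + 2) → ℝ≥0∞} (hg : Measurable g) :
    Measurable (M.stepOp μ g) := by
  refine measurable_strategy_apply μ
    (g := fun u π => Fin.cases 0 (fun v => M.expect g (M.predict (M.D v) π)) u) fun u => ?_
  refine Fin.cases ?_ (fun v => ?_) u
  · exact measurable_const
  · exact (M.measurable_expect hg).comp (M.measurable_predict _)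

lemma stepOp_add (μ : Strategy n L) {g : Belief (n + 2) → ℝ≥0∞} (hg : Measurable g)
    (g' : Belief (n + 2) → ℝ≥0∞) (π : Belief (n + 2)) :
    M.stepOp μ (fun π => g π + g' π) π = M.stepOp μ g π + M.stepOp μ g' π := by
  unfold stepOp
  refine Fin.cases ?_ (fun v => ?_) (μ.1 π)
  · simp
  · exact M.expect_add hg g' _

lemma avg_kill (μ : Strategy n L) {G : State n → ℝ≥0∞} (hG : Measurable G)
    (π : Belief (n + 2)) :
    avg (fun z => if μ.1 z.2 = 0 then 0 else ∫⁻ w, G w ∂(M.strategyKernel μ z)) π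
      = M.stepOp μ (avg G) π := by
  have h : ∀ u : Fin (L + 1), (∑ x, ENNReal.ofReal (π x) *
      (if u = 0 then 0 else ∫⁻ w, G w ∂(M.actionKernel u (x, π))))
      = (Fin.cases 0 (fun v => M.expect (avg G) (M.predict (M.D v) π)) u : ℝ≥0∞) := by
    intro u
    refine Fin.cases ?_ (fun v => ?_) u
    · simp
    · simp only [Fin.succ_ne_zero, if_false]
      exact M.avg_lintegral_continueKernel v hG π
  exact h (μ.1 π)

/-! ### The law of the controlled process -/

instance (π : Belief (n + 2)) : IsProbabilityMeasure (initialLaw π) where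
  measure_univ := by
    simp only [initialLaw, Measure.coe_finsetSum, Finset.sum_apply, Measure.smul_apply,
      measure_univ, smul_eq_mul, mul_one]
    rw [← ENNReal.ofReal_sum_of_nonneg fun i _ => π.nonneg i, π.sum_eq_one, ENNReal.ofReal_one]

lemma lintegral_initialLaw (π : Belief (n + 2)) (G : State n → ℝ≥0∞) :
    ∫⁻ z, G z ∂(initialLaw π) = avg G π := by
  rw [initialLaw, lintegral_finsetSum_measure]
  refine Finset.sum_congr rfl fun x _ => ?_
  rw [lintegral_smul_measure, smul_eq_mul, lintegral_dirac]

lemma lintegral_pathLaw_zero (μ : Strategy n L) (π : Belief (n + 2)) {G : State n → ℝ≥0∞}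
    (hG : Measurable G) : ∫⁻ ω, G (ω 0) ∂(M.pathLaw μ π) = avg G π := by
  have h0 : (M.pathLaw μ π).map (Preorder.frestrictLe (π := fun _ : ℕ => State n) 0)
      = (initialLaw π).map
        (MeasurableEquiv.piUnique fun _ : Finset.Iic 0 => State n).symm := by
    rw [pathLaw, Kernel.trajMeasure, Measure.map_comp _ _ (by fun_prop),
      Kernel.traj_map_frestrictLe, Kernel.partialTraj_self, Measure.id_comp]
  have hm : Measurable fun h : (i : Finset.Iic 0) → (fun _ : ℕ => State n) i =>
      G (h ⟨0, Finset.mem_Iic.2 le_rfl⟩) := hG.comp (measurable_pi_apply _)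
  have h1 : ∫⁻ ω, G (ω 0) ∂(M.pathLaw μ π)
      = ∫⁻ h, G (h ⟨0, Finset.mem_Iic.2 le_rfl⟩)
        ∂((M.pathLaw μ π).map (Preorder.frestrictLe (π := fun _ : ℕ => State n) 0)) := by
    rw [lintegral_map hm (by fun_prop)]
    rfl
  rw [h1, h0, lintegral_map hm (MeasurableEquiv.measurable _), ← lintegral_initialLaw]
  rfl

open scoped Classical in
/-- The Markov property, for a function of the state at epoch `k + 1` on the event that the
strategy has not stopped before. -/
lemma lintegral_pathLaw_succ (μ : Strategy n L) (π : Belief (n + 2)) {G : State n → ℝ≥0∞}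
    (hG : Measurable G) (k : ℕ) :
    ∫⁻ ω, (if ∀ j < k + 1, μ.1 (ω j).2 ≠ 0 then G (ω (k + 1)) else 0) ∂(M.pathLaw μ π)
      = ∫⁻ ω, (if ∀ j < k, μ.1 (ω j).2 ≠ 0 then
          (if μ.1 (ω k).2 = 0 then 0 else ∫⁻ w, G w ∂(M.strategyKernel μ (ω k))) else 0)
          ∂(M.pathLaw μ π) := by
  set r := Preorder.frestrictLe (π := fun _ : ℕ => State n) k with hr
  have hrm : Measurable r := by fun_prop
  set S : Set ((i : Finset.Iic k) → (fun _ : ℕ => State n) i) :=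
    {h | ∀ j, μ.1 (h j).2 ≠ 0} with hS
  have hSm : MeasurableSet S := by
    have : S = ⋂ j, {h | μ.1 (h j).2 ≠ 0} := by ext h; simp [hS]
    rw [this]
    refine MeasurableSet.iInter fun j => ?_
    exact (μ.2.comp (measurable_snd.comp (measurable_pi_apply j)))
      (MeasurableSet.singleton (0 : Fin (L + 1))).compl
  have hrS : ∀ ω : ℕ → State n, r ω ∈ S ↔ ∀ j < k + 1, μ.1 (ω j).2 ≠ 0 := fun ω =>
    ⟨fun h j hj => h ⟨j, Finset.mem_Iic.2 (by omega)⟩,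
      fun h j => h j (Nat.lt_succ_of_le (Finset.mem_Iic.1 j.2))⟩
  set F : ((i : Finset.Iic k) → (fun _ : ℕ => State n) i) × State n → ℝ≥0∞ :=
    fun p => S.indicator (fun _ => G p.2) p.1 with hF
  have hFm : Measurable F := by
    have : F = (Prod.fst ⁻¹' S).indicator fun p => G p.2 := by
      funext p; simp only [hF, Set.indicator, Set.mem_preimage]
    rw [this]
    exact (hG.comp measurable_snd).indicator (measurable_fst hSm)
  have h1 : ∫⁻ ω, (if ∀ j < k + 1, μ.1 (ω j).2 ≠ 0 then G (ω (k + 1)) else 0) ∂(M.pathLaw μ π)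
      = ∫⁻ p, F p ∂((M.pathLaw μ π).map fun ω => (r ω, ω (k + 1))) := by
    rw [lintegral_map hFm (by fun_prop)]
    refine lintegral_congr fun ω => ?_
    simp only [hF, Set.indicator, hrS]
  have h2 : (M.pathLaw μ π).map (fun ω => (r ω, ω (k + 1)))
      = (M.pathLaw μ π).map r ⊗ₘ M.historyKernel μ k :=
    (Kernel.map_frestrictLe_trajMeasure_compProd_eq_map_trajMeasure).symm
  have hprob : IsProbabilityMeasure (M.pathLaw μ π) := by
    unfold pathLaw; infer_instance
  have hprob' : IsProbabilityMeasure ((M.pathLaw μ π).map r) :=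
    Measure.isProbabilityMeasure_map hrm.aemeasurable
  rw [h1, h2, Measure.lintegral_compProd hFm, lintegral_map
    (Measurable.lintegral_kernel_prod_right' hFm) hrm]
  refine lintegral_congr fun ω => ?_
  have h3 : (∀ j < k + 1, μ.1 (ω j).2 ≠ 0) ↔ (∀ j < k, μ.1 (ω j).2 ≠ 0) ∧ μ.1 (ω k).2 ≠ 0 :=
    Nat.forall_lt_succ_right
  change ∫⁻ w, F (r ω, w) ∂(M.strategyKernel μ (ω k)) = _
  simp only [hF, Set.indicator, hrS, h3]
  by_cases hk : μ.1 (ω k).2 = 0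
  · simp [hk]
  · by_cases hj : ∀ j < k, μ.1 (ω j).2 ≠ 0
    · simp only [ne_eq, hk, not_false_eq_true, and_true, if_false]
      exact (lintegral_congr fun w => if_pos hj).trans (if_pos hj).symm
    · simp [hk, hj]

open scoped Classical in
lemma lintegral_pathLaw (μ : Strategy n L) (π : Belief (n + 2)) (k : ℕ) :
    ∀ {G : State n → ℝ≥0∞}, Measurable G →
    ∫⁻ ω, (if ∀ j < k, μ.1 (ω j).2 ≠ 0 then G (ω k) else 0) ∂(M.pathLaw μ π)
      = (M.stepOp μ)^[k] (avg G) π := by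
  induction k with
  | zero =>
    intro G hG
    simpa using M.lintegral_pathLaw_zero μ π hG
  | succ k ih =>
    intro G hG
    have hm : Measurable fun z : State n =>
        if μ.1 z.2 = 0 then 0 else ∫⁻ w, G w ∂(M.strategyKernel μ z) :=
      Measurable.ite ((μ.2.comp measurable_snd) (MeasurableSet.singleton 0)) measurable_const
        hG.lintegral_kernel
    rw [M.lintegral_pathLaw_succ μ π hG k, ih hm]
    rw [show avg (fun z => if μ.1 z.2 = 0 then 0 else ∫⁻ w, G w ∂(M.strategyKernel μ z))
      = M.stepOp μ (avg G) from funext fun π => M.avg_kill μ hG π]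
    rfl

/-! ### The value is the limit of value iteration -/

/-- Cost of one epoch under a strategy. -/
noncomputable def strategyCost (μ : Strategy n L) (π : Belief (n + 2)) : ℝ≥0∞ :=
  ENNReal.ofReal (M.cost π (μ.1 π))

lemma measurable_strategyCost (μ : Strategy n L) : Measurable (M.strategyCost μ) :=
  measurable_strategy_apply μ (g := fun u π => ENNReal.ofReal (M.cost π u)) fun u =>
    (M.measurable_cost u).ennreal_ofReal

/-- Expected cost of the first `K` epochs. -/
noncomputable def partialCost (μ : Strategy n L) (K : ℕ) (π : Belief (n + 2)) : ℝ≥0∞ :=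
  ∑ k ∈ Finset.range K, (M.stepOp μ)^[k] (M.strategyCost μ) π

lemma measurable_stepOp_iterate (μ : Strategy n L) (k : ℕ) :
    Measurable ((M.stepOp μ)^[k] (M.strategyCost μ)) := by
  induction k with
  | zero => exact M.measurable_strategyCost μ
  | succ k ih => rw [Function.iterate_succ_apply']; exact M.measurable_stepOp μ ih

lemma objective_eq (μ : Strategy n L) (π : Belief (n + 2)) :
    M.objective μ π = ⨆ K, M.partialCost μ K π := by
  classical
  have hmeas : ∀ k : ℕ, Measurable fun ω : ℕ → State n =>
      if ∀ j < k, μ.1 (ω j).2 ≠ 0 then ENNReal.ofReal (M.cost (ω k).2 (μ.1 (ω k).2)) else 0 := by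
    intro k
    refine Measurable.ite ?_ ((M.measurable_strategyCost μ).comp
      (measurable_snd.comp (measurable_pi_apply k))) measurable_const
    have : {ω : ℕ → State n | ∀ j < k, μ.1 (ω j).2 ≠ 0}
        = ⋂ j, ⋂ (_ : j < k), {ω | μ.1 (ω j).2 ≠ 0} := by ext ω; simp
    rw [this]
    refine MeasurableSet.iInter fun j => MeasurableSet.iInter fun _ => ?_
    exact (μ.2.comp (measurable_snd.comp (measurable_pi_apply j)))
      (MeasurableSet.singleton (0 : Fin (L + 1))).compl
  have h : ∀ k : ℕ, ∫⁻ ω, (if ∀ j < k, μ.1 (ω j).2 ≠ 0 then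
      ENNReal.ofReal (M.cost (ω k).2 (μ.1 (ω k).2)) else 0) ∂(M.pathLaw μ π)
      = (M.stepOp μ)^[k] (M.strategyCost μ) π := by
    intro k
    have := M.lintegral_pathLaw μ π k (G := fun z => M.strategyCost μ z.2)
      ((M.measurable_strategyCost μ).comp measurable_snd)
    rwa [show avg (fun z : State n => M.strategyCost μ z.2) = M.strategyCost μ from
      funext fun π => avg_snd _ π] at this
  unfold objective totalCost
  rw [lintegral_tsum fun k => ?_]
  · rw [ENNReal.tsum_eq_iSup_nat]
    refine iSup_congr fun K => Finset.sum_congr rfl fun k _ => ?_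
    rw [← h k]
  · convert (hmeas k).aemeasurable

lemma partialCost_succ (μ : Strategy n L) (K : ℕ) (π : Belief (n + 2)) :
    M.partialCost μ (K + 1) π = M.actionValue (M.partialCost μ K) (μ.1 π) π := by
  have hsum : ∀ K π, M.stepOp μ (M.partialCost μ K) π
      = ∑ k ∈ Finset.range K, (M.stepOp μ)^[k + 1] (M.strategyCost μ) π := by
    intro K
    induction K with
    | zero =>
      intro π
      have : M.partialCost μ 0 = fun _ => 0 := by funext π; simp [partialCost]
      rw [this, Finset.range_zero, Finset.sum_empty]
      unfold stepOp
      refine Fin.cases rfl (fun v => ?_) (μ.1 π)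
      simp [expect]
    | succ K ih =>
      intro π
      have : M.partialCost μ (K + 1)
          = fun π => M.partialCost μ K π + (M.stepOp μ)^[K] (M.strategyCost μ) π := by
        funext π; simp [partialCost, Finset.sum_range_succ]
      rw [this, M.stepOp_add μ, ih, Finset.sum_range_succ, Function.iterate_succ_apply']
      exact Finset.measurable_sum _ fun k _ => M.measurable_stepOp_iterate μ k
  rw [actionValue_eq_stepOp, hsum, partialCost, Finset.sum_range_succ', add_comm]
  rfl

lemma valueLim_le_objective (μ : Strategy n L) (π : Belief (n + 2)) :
    M.valueLim π ≤ M.objective μ π := by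
  have h : ∀ K, M.valueIter K ≤ M.partialCost μ K := by
    intro K
    induction K with
    | zero => exact fun _ => zero_le
    | succ K ih =>
      intro π
      rw [partialCost_succ]
      exact (iInf_le _ (μ.1 π)).trans (M.actionValue_mono ih _ _)
  rw [objective_eq]
  exact iSup_mono fun K => h K π

/-- A measurable choice of a minimizer among finitely many measurable functions. -/
lemma exists_measurable_argmin {Ω : Type*} [MeasurableSpace Ω] {q : Fin (L + 1) → Ω → ℝ≥0∞}
    (hq : ∀ u, Measurable (q u)) :
    ∃ s : Ω → Fin (L + 1), Measurable s ∧ ∀ x v, q (s x) x ≤ q v x := by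
  classical
  have hex : ∀ x, ∃ k : ℕ, ∀ v, q (Fin.ofNat (L + 1) k) x ≤ q v x := fun x => by
    obtain ⟨u, -, hu⟩ := Finset.exists_min_image Finset.univ (fun u => q u x)
      Finset.univ_nonempty
    exact ⟨u, fun v => by rw [Fin.ofNat_val_eq_self]; exact hu v (Finset.mem_univ v)⟩
  refine ⟨fun x => Fin.ofNat (L + 1) (Nat.find (hex x)), ?_, fun x => Nat.find_spec (hex x)⟩
  refine (measurable_from_nat (f := fun k => Fin.ofNat (L + 1) k)).comp
    (measurable_find hex fun k => ?_)
  have : {x | ∀ v, q (Fin.ofNat (L + 1) k) x ≤ q v x}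
      = ⋂ v, {x | q (Fin.ofNat (L + 1) k) x ≤ q v x} := by ext; simp
  rw [this]
  exact MeasurableSet.iInter fun v => measurableSet_le (hq _) (hq v)

/-- The lower bound by value iteration is attained by a strategy that is greedy with respect to its
limit. -/
theorem value_eq_valueLim : M.value = M.valueLim := by
  funext π
  refine le_antisymm ?_ (le_iInf fun μ => M.valueLim_le_objective μ π)
  obtain ⟨s, hs, hmin⟩ := exists_measurable_argmin
    fun u => M.measurable_actionValue M.measurable_valueLim u
  refine (iInf_le _ ⟨s, hs⟩).trans ?_
  have h : ∀ K, M.partialCost ⟨s, hs⟩ K ≤ M.valueLim := by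
    intro K
    induction K with
    | zero => intro π; simp [partialCost]
    | succ K ih =>
      intro π
      rw [partialCost_succ]
      refine (M.actionValue_mono ih _ _).trans ?_
      rw [← M.bellman_valueLim]
      refine le_iInf fun v => ?_
      rw [M.bellman_valueLim]
      exact hmin π v
  rw [objective_eq]
  exact iSup_le fun K => h K π

lemma Q_eq (π : Belief (n + 2)) (u : Fin (L + 1)) :
    M.Q π u = M.actionValue M.valueLim u π := by
  refine Fin.cases ?_ (fun v => ?_) u
  · rw [actionValue_zero]; rfl
  · rw [actionValue_succ, ← M.lintegral_filter, ← M.value_eq_valueLim]; rfl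

/-! ### Stopping sets -/

lemma mem_stoppingSet_iff (π : Belief (n + 2)) :
    π ∈ M.stoppingSet ↔ ∀ u : Fin L,
      ENNReal.ofReal (M.cost π 0) ≤ M.actionValue M.valueLim u.succ π := by
  simp only [stoppingSet, Set.mem_ofPred_eq, Q_eq, actionValue_zero]

/-- Stopping costs are linear and the values of the other actions are concave. -/
lemma convex_stoppingSet : Convex ℝ (Subtype.val '' M.stoppingSet) := by
  rintro _ ⟨π₁, h₁, rfl⟩ _ ⟨π₂, h₂, rfl⟩ a b ha hb hab
  refine ⟨⟨a • π₁.1 + b • π₂.1, convex_stdSimplex ℝ _ π₁.2 π₂.2 ha hb hab⟩, ?_, rfl⟩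
  rw [mem_stoppingSet_iff] at h₁ h₂ ⊢
  intro u
  set π : Belief (n + 2) :=
    ⟨a • π₁.1 + b • π₂.1, convex_stdSimplex ℝ _ π₁.2 π₂.2 ha hb hab⟩ with hπ
  have hcomb : ∀ i, π i = a * π₁ i + b * π₂ i := fun i => rfl
  rw [M.cost_convexComb hcomb, ENNReal.ofReal_add (mul_nonneg ha (M.cost_nonneg _ _))
    (mul_nonneg hb (M.cost_nonneg _ _)), ENNReal.ofReal_mul ha, ENNReal.ofReal_mul hb]
  exact (add_le_add (mul_le_mul_right (h₁ u) _) (mul_le_mul_right (h₂ u) _)).trans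
    (M.beliefConcave_actionValue M.measurable_valueLim M.beliefConcave_valueLim u.succ
      a b π π₁ π₂ ha hb hab hcomb)

lemma e1_mem_stoppingSet : e1 ∈ M.stoppingSet := by
  rw [mem_stoppingSet_iff]
  intro u
  have : M.cost e1 0 = 0 := by
    rw [cost_zero]
    refine Finset.sum_eq_zero fun i _ => ?_
    by_cases hi : i = 0
    · simp [hi]
    · have : (e1 : Belief (n + 2)) i = 0 := Pi.single_eq_of_ne hi 1
      rw [this, mul_zero]
  rw [this, ENNReal.ofReal_zero]
  exact zero_le

lemma myopicStoppingSet_subset : M.myopicStoppingSet ⊆ M.stoppingSet := by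
  intro π hπ
  rw [mem_stoppingSet_iff]
  intro u
  rw [actionValue_succ]
  exact (ENNReal.ofReal_le_ofReal (hπ u).le).trans le_self_add

/-! ### The myopic bound -/

lemma optimal_le_myopic (hA : TP2 M.A) (hB : TP2 M.B) (hA2 : MatrixOrder M.A (M.A ^ 2))
    (hm : M.SamplingCostMonotone) {α : ℝ} (hα : M.AlphaLarge α) (hmono : M.AlphaMonotone α)
    {π : Belief (n + 2)} {u : Fin L} {w : Fin (L + 1)} (hu : u ∈ M.myopicActions α π)
    (hw : w ∈ M.optimalActions π)
    (hsel : IsLeast (M.optimalActions π) w ∨ IsGreatest (M.myopicActions α π) u) :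
    w ≤ u.succ := by
  by_contra hlt
  rw [not_le] at hlt
  obtain ⟨v, rfl⟩ := Fin.exists_succ_eq.2 ((Fin.zero_le u.succ).trans_lt hlt).ne'
  have huv : u < v := Fin.succ_lt_succ_iff.1 hlt
  set δ := M.transformedCost α π v.succ - M.transformedCost α π u.succ with hδ
  have hδ0 : 0 ≤ δ := sub_nonneg.2 (hu v)
  have key := M.actionValue_add_le hA hB hA2 hm hα hmono huv.le hδ0
    (show M.transformedCost α π u.succ + δ ≤ M.transformedCost α π v.succ by
      rw [hδ]; linarith)
  rw [← Q_eq, ← Q_eq] at key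
  rcases hsel with hsel | hsel
  · have hopt : u.succ ∈ M.optimalActions π := fun z => (le_self_add.trans key).trans (hw z)
    exact absurd (hsel.2 hopt) (not_le.2 hlt)
  · have hδpos : 0 < δ := by
      refine lt_of_le_of_ne hδ0 fun h0 => absurd (hsel.2 (?_ : v ∈ M.myopicActions α π))
        (not_le.2 huv)
      intro z
      have := hu z
      linarith
    have hfin : M.Q π u.succ ≠ ∞ := by
      rw [Q_eq]; exact M.actionValue_valueLim_ne_top _ _
    have hlt' : M.Q π u.succ < M.Q π u.succ + ENNReal.ofReal δ :=
      ENNReal.lt_add_right hfin (by simpa using hδpos)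
    exact absurd (hlt'.trans_le (key.trans (hw u.succ))) (lt_irrefl _)

/-- Extreme minimizers are monotone, as the transformed costs have decreasing differences. -/
lemma myopic_le_of_mlrGe (hA : TP2 M.A) (hA2 : MatrixOrder M.A (M.A ^ 2))
    (hm : M.SamplingCostMonotone) {α : ℝ} (hα : 0 < α) {μbar : Belief (n + 2) → Fin L}
    (hsel : (∀ π, IsLeast (M.myopicActions α π) (μbar π)) ∨
      ∀ π, IsGreatest (M.myopicActions α π) (μbar π))
    {π₁ π₂ : Belief (n + 2)} (h : MLRGe π₁ π₂) : μbar π₂ ≤ μbar π₁ := by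
  by_contra hlt
  rw [not_le] at hlt
  have hmem : ∀ π, μbar π ∈ M.myopicActions α π := fun π =>
    hsel.elim (fun h => (h π).1) fun h => (h π).1
  have hd := M.transformedCost_sub_le hA hA2 hα hm hlt.le h
  have h1 := hmem π₁ (μbar π₂)
  have h2 := hmem π₂ (μbar π₁)
  rcases hsel with hsel | hsel
  · have : μbar π₁ ∈ M.myopicActions α π₂ := fun z => by
      have := hmem π₂ z
      linarith
    exact absurd ((hsel π₂).2 this) (not_le.2 hlt)
  · have : μbar π₂ ∈ M.myopicActions α π₁ := fun z => by
      have := hmem π₁ z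
      linarith
    exact absurd ((hsel π₁).2 this) (not_le.2 hlt)

/-! ### Two states -/

section TwoStates

variable (N : Model 0 L)

lemma two_row_zero : N.A 0 1 = 0 := by
  have h := N.A_row_sum 0
  rw [Fin.sum_univ_two, N.A_absorbing] at h
  linarith

lemma two_row_one : N.A 1 1 = 1 - N.A 1 0 := by
  have h := N.A_row_sum 1
  rw [Fin.sum_univ_two] at h
  linarith

lemma eq_zero_and_eq_one_of_lt : ∀ {i j : Fin (0 + 2)}, i < j → i = 0 ∧ j = 1 := by decide

lemma tp2_two : TP2 N.A := by
  intro i i' j j' hi hj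
  obtain ⟨rfl, rfl⟩ : i = 0 ∧ i' = 1 := eq_zero_and_eq_one_of_lt hi
  obtain ⟨rfl, rfl⟩ : j = 0 ∧ j' = 1 := eq_zero_and_eq_one_of_lt hj
  rw [N.two_row_zero, zero_mul, sub_zero]
  exact mul_nonneg (N.A_nonneg _ _) (N.A_nonneg _ _)

lemma matrixOrder_two : MatrixOrder N.A (N.A ^ 2) := by
  intro i m j j' hj
  obtain ⟨rfl, rfl⟩ : j = 0 ∧ j' = 1 := eq_zero_and_eq_one_of_lt hj
  have h0 := N.two_row_zero
  have h1 := N.two_row_one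
  have hp := N.A_nonneg 1 0
  have hq := N.A_nonneg 1 1
  have e : ∀ a b, (N.A ^ 2) a b = N.A a 0 * N.A 0 b + N.A a 1 * N.A 1 b := fun a b => by
    rw [pow_two, Matrix.mul_apply, Fin.sum_univ_two]
  have hm : m = 0 ∨ m = 1 := by omega
  have hi : i = 0 ∨ i = 1 := by omega
  rcases hm with rfl | rfl
  · simp [e, h0]
  · rcases hi with rfl | rfl
    · simp only [e, h0, N.A_absorbing]
      nlinarith
    · simp only [e, h0, N.A_absorbing]
      rw [h1] at hq ⊢
      nlinarith [mul_nonneg hp hq, mul_nonneg (mul_nonneg hp hq) hp]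

lemma alphaMonotone_two (α : ℝ) : N.AlphaMonotone α := by
  intro u i k hi hik
  obtain rfl : i = k := hik.eq_of_not_lt fun h => hi (eq_zero_and_eq_one_of_lt h).1
  exact le_rfl

lemma mlrGe_two {π₁ π₂ : Belief 2} (h : π₁ 0 ≤ π₂ 0) : MLRGe π₁ π₂ := by
  intro i j hij
  obtain ⟨rfl, rfl⟩ : i = 0 ∧ j = 1 := eq_zero_and_eq_one_of_lt hij
  have h1 := π₁.sum_eq_one
  have h2 := π₂.sum_eq_one
  rw [Fin.sum_univ_two] at h1 h2
  have e1 : π₁ 1 = 1 - π₁ 0 := by linarith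
  have e2 : π₂ 1 = 1 - π₂ 0 := by linarith
  rw [e1, e2]
  linarith

end TwoStates

end Model
end QuickestDetection

/-- Quickest detection with optimal sampling and phase-type distributed change time.

Where a minimizer is not unique, the bound `μ* ≤ μ̄` is stated for a strategy `μ*` that takes the
smallest optimal action and an arbitrary myopic `μ̄`, and for an arbitrary optimal `μ*` and a `μ̄`
that takes the largest myopic action; monotonicity of `μ̄` is stated for both extreme selections. -/
theorem theorem5 {n L : ℕ} (M : QuickestDetection.Model n L) :
    -- the stopping set is convex and contains `e₁`
    (Convex ℝ (Subtype.val '' M.stoppingSet) ∧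
      QuickestDetection.Model.e1 ∈ M.stoppingSet) ∧
    -- the stopping set contains the myopic stopping set
    M.myopicStoppingSet ⊆ M.stoppingSet ∧
    -- upper bound and monotonicity in the MLR order
    (QuickestDetection.TP2 M.A → QuickestDetection.TP2 M.B →
      QuickestDetection.MatrixOrder M.A (M.A ^ 2) → M.SamplingCostMonotone →
      ∀ α : ℝ, M.AlphaLarge α → M.AlphaMonotone α →
      ∀ μbar : QuickestDetection.Belief (n + 2) → Fin L, (∀ π, μbar π ∈ M.myopicActions α π) →
        (∀ μstar : QuickestDetection.Belief (n + 2) → Fin (L + 1),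
          (∀ π, μstar π ∈ M.optimalActions π) →
          (∀ π, IsLeast (M.optimalActions π) (μstar π)) ∨
            (∀ π, IsGreatest (M.myopicActions α π) (μbar π)) →
          ∀ π, π ∉ M.myopicStoppingSet → μstar π ≤ (μbar π).succ) ∧
        ((∀ π, IsLeast (M.myopicActions α π) (μbar π)) ∨
            (∀ π, IsGreatest (M.myopicActions α π) (μbar π)) →
          ∀ π₁ π₂, QuickestDetection.MLRGe π₁ π₂ → μbar π₂ ≤ μbar π₁)) ∧
    -- geometrically distributed change time, `X = 2`
    (n = 0 →
      QuickestDetection.TP2 M.A ∧ QuickestDetection.MatrixOrder M.A (M.A ^ 2) ∧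
      (QuickestDetection.TP2 M.B → M.SamplingCostMonotone →
        ∀ α : ℝ, M.AlphaLarge α →
        ∀ μbar : QuickestDetection.Belief (n + 2) → Fin L,
          (∀ π, μbar π ∈ M.myopicActions α π) →
          (∀ μstar : QuickestDetection.Belief (n + 2) → Fin (L + 1),
            (∀ π, μstar π ∈ M.optimalActions π) →
            (∀ π, IsLeast (M.optimalActions π) (μstar π)) ∨
              (∀ π, IsGreatest (M.myopicActions α π) (μbar π)) →
            ∀ π, μstar π ≤ (μbar π).succ) ∧
          ((∀ π, IsLeast (M.myopicActions α π) (μbar π)) ∨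
              (∀ π, IsGreatest (M.myopicActions α π) (μbar π)) →
            ∀ π₁ π₂ : QuickestDetection.Belief (n + 2), π₁ 0 ≤ π₂ 0 → μbar π₂ ≤ μbar π₁))) := by
  refine ⟨⟨M.convex_stoppingSet, M.e1_mem_stoppingSet⟩, M.myopicStoppingSet_subset, ?_, ?_⟩
  · intro hA hB hA2 hm α hα hmono μbar hbar
    refine ⟨fun μstar hstar hsel π _ => ?_, fun hsel π₁ π₂ h => ?_⟩
    · exact M.optimal_le_myopic hA hB hA2 hm hα hmono (hbar π) (hstar π)
        (hsel.imp (fun h => h π) fun h => h π)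
    · exact M.myopic_le_of_mlrGe hA hA2 hm hα.1 hsel h
  · rintro rfl
    refine ⟨M.tp2_two, M.matrixOrder_two, fun hB hm α hα μbar hbar =>
      ⟨fun μstar hstar hsel π => ?_, fun hsel π₁ π₂ h => ?_⟩⟩
    · exact M.optimal_le_myopic M.tp2_two hB M.matrixOrder_two hm hα (M.alphaMonotone_two α)
        (hbar π) (hstar π) (hsel.imp (fun h => h π) fun h => h π)
    · exact M.myopic_le_of_mlrGe M.tp2_two M.matrixOrder_two hm hα.1 hsel
        (QuickestDetection.Model.mlrGe_two h)
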